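/- Let $(M,\omega)$ be a 2-plectic manifold: $M$ is a smooth manifold and $\omega$ is a closed 3-form such that $\iota_v\omega=0$ implies $v=0$ for every tangent vector $v$. Let $C\to M$ be a smooth real vector bundle with a smooth nondegenerate symmetric bilinear form $\langle\cdot,\cdot\rangle$ and a smooth bundle map $\rho\colon C\to TM$ (the anchor), and let $\rho^*\colon T^*M\to C$ be the dual map, $\langle\rho^*\alpha,e\rangle=\alpha(\rho(e))$. Suppose that $0\to T^*M\xrightarrow{\rho^*}C\xrightarrow{\rho}TM\to0$ is exact, and let $s\colon TM\to C$ be a splitting: a smooth bundle map with $\rho\circ s=\mathrm{id}$ and $\langle s(v),s(w)\rangle=0$ for all $v,w$. Every section of $C$ is then uniquely $e=s(v)+\rho^*\alpha$ with a vector field $v$ and a 1-form $\alpha$; write $s(v)+\alpha$ for it. Equip $\Gamma(C)$ with the twisted Courant bracket $$[\![ s(v_1)+\alpha_1,\,s(v_2)+\alpha_2 ]\!]_\omega = s([v_1,v_2])+\mathcal L_{v_1}\alpha_2-\mathcal L_{v_2}\alpha_1-\tfrac12 d(\iota_{v_1}\alpha_2-\iota_{v_2}\alpha_1)-\iota_{v_2}\iota_{v_1}\omega$$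 and with the twisted Dorfman bracket $$(s(v_1)+\alpha_1)\circ(s(v_2)+\alpha_2)=s([v_1,v_2])+\mathcal L_{v_1}\alpha_2-\iota_{v_2}d\alpha_1-\iota_{v_2}\iota_{v_1}\omega .$$ (This is, up to isomorphism, the exact Courant algebroid with a splitting of curvature $-\omega$.) Let $D=\rho^*d\colon C^\infty(M)\to\Gamma(C)$, and let $\Gamma(C)^s$ be the set of all $e=s(v)+\alpha\in\Gamma(C)$ that preserve the splitting, i.e. $e\circ s(v')=s([v,v'])$ for every vector field $v'$. A Lie 2-algebra is a complex $L_1\xrightarrow{d}L_0$ of real vector spaces with a skew-symmetric chain map $[\cdot,\cdot]\colon L\otimes L\to L$ and a skew-symmetric chain homotopy $J\colon L^{\otimes3}\to L$ from $x\otimes y\otimes z\mapsto[x,[y,z]]$ to $x\otimes y\otimes z\mapsto[[x,y],z]+[y,[x,z]]$ (so that $[x,[y,z]]-[[x,y],z]-[y,[x,z]]=dJ(x,y,z)$ in degree $0$), such that $$[x,J(y,z,w)]+J(x,[y,z],w)+J(x,z,[y,w])+[J(x,y,z),w]+[z,J(x,y,w)]$$ $$=J(x,y,[z,w])+J([x,y],z,w)+[y,J(x,z,w)]+J(y,[x,z],w)+J(y,z,[x,w]).$$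 Then: 1. There is a Lie 2-algebra $L_\infty(C)$ with $L_0=\Gamma(C)$, $L_1=C^\infty(M)$, differential $D$, bracket $[e_1,e_2]=[\![e_1,e_2]\!]_\omega$ in degree $0$ and $[e,f]=-[f,e]=\tfrac12\langle e,Df\rangle$ in degree $1$, and Jacobiator $$J(e_1,e_2,e_3)=-\tfrac16\big(\langle[\![e_1,e_2]\!]_\omega,e_3\rangle+\langle[\![e_3,e_1]\!]_\omega,e_2\rangle+\langle[\![e_2,e_3]\!]_\omega,e_1\rangle\big).$$ 2. $\Gamma(C)^s$ is a linear subspace of $\Gamma(C)$, it contains $D(C^\infty(M))$, and it is closed under $[\![\cdot,\cdot]\!]_\omega$. 3. Hence $C^\infty(M)\xrightarrow{D}\Gamma(C)^s$, with the restricted bracket and Jacobiator, is a Lie 2-algebra $L_\infty(C)^s$, a sub-Lie 2-algebra of $L_\infty(C)$. -/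

import Mathlib

open Bundle Set
open scoped Manifold ContDiff Topology

set_option linter.unusedSectionVars false

/-! ### Lie 2-algebras -/

/-- A Lie 2-algebra on the two-term complex of real vector spaces `d : L₁ → L₀`: a skew-symmetric
chain map `[·,·] : L ⊗ L → L` and a skew-symmetric chain homotopy `J : L ⊗ L ⊗ L → L` from
`[x,[y,z]]` to `[[x,y],z] + [y,[x,z]]`, subject to one coherence law.

By graded skew-symmetry the bracket consists of `bracket₀ : L₀ ⊗ L₀ → L₀` and
`bracket₁ : L₀ ⊗ L₁ → L₁`, with `[f,x] = -[x,f]`, while `[f,g] = 0` for degree reasons.  A homotopy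
`h` from `F` to `G` satisfies `F - G = d h + h d`. -/
structure Lie2Algebra (L₁ L₀ : Type*) [AddCommGroup L₁] [Module ℝ L₁]
    [AddCommGroup L₀] [Module ℝ L₀] where
  /-- the differential -/
  d : L₁ →ₗ[ℝ] L₀
  /-- the bracket `[x,y]` of two elements of degree `0` -/
  bracket₀ : L₀ →ₗ[ℝ] L₀ →ₗ[ℝ] L₀
  /-- the bracket `[x,f]` of an element of degree `0` with one of degree `1` -/
  bracket₁ : L₀ →ₗ[ℝ] L₁ →ₗ[ℝ] L₁
  /-- the Jacobiator -/
  J : L₀ →ₗ[ℝ] L₀ →ₗ[ℝ] L₀ →ₗ[ℝ] L₁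
  bracket_skew : ∀ x y, bracket₀ x y = -bracket₀ y x
  /-- the bracket is a chain map in degree `1`: `d [x,f] = [x,df]` -/
  d_bracket : ∀ x f, d (bracket₁ x f) = bracket₀ x (d f)
  /-- the bracket is a chain map in degree `2`: `0 = [df,g] - [f,dg]`, where `[f,dg] = -[dg,f]` -/
  bracket_d : ∀ f g, bracket₁ (d f) g = -bracket₁ (d g) f
  J_skew_left : ∀ x y z, J x y z = -J y x z
  J_skew_right : ∀ x y z, J x y z = -J x z y
  /-- the homotopy equation on `L₀ ⊗ L₀ ⊗ L₀` -/
  homotopy₀ : ∀ x y z,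
    bracket₀ x (bracket₀ y z) - (bracket₀ (bracket₀ x y) z + bracket₀ y (bracket₀ x z))
      = d (J x y z)
  /-- the homotopy equation on `L₀ ⊗ L₀ ⊗ L₁`; the equations on `L₀ ⊗ L₁ ⊗ L₀` and
  `L₁ ⊗ L₀ ⊗ L₀` are the same one, by skew-symmetry -/
  homotopy₁ : ∀ x y f,
    bracket₁ x (bracket₁ y f) - (bracket₁ (bracket₀ x y) f + bracket₁ y (bracket₁ x f))
      = J x y (d f)
  /-- the coherence law; the summand `[J(x,y,z),w]` is `-[w,J(x,y,z)]` -/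
  coherence : ∀ x y z w,
    bracket₁ x (J y z w) + J x (bracket₀ y z) w + J x z (bracket₀ y w)
        + -bracket₁ w (J x y z) + bracket₁ z (J x y w)
      = J x y (bracket₀ z w) + J (bracket₀ x y) z w
        + bracket₁ y (J x z w) + J y (bracket₀ x z) w + J y z (bracket₀ x w)

/-- `K`, with underlying complex `L₁ → S` for a subspace `S` of `L₀`, is a sub-Lie 2-algebra of
`L`: all structure maps of `K` are the restrictions of those of `L`. -/
structure Lie2Algebra.IsRestriction {L₁ L₀ : Type*} [AddCommGroup L₁] [Module ℝ L₁]
    [AddCommGroup L₀] [Module ℝ L₀] (L : Lie2Algebra L₁ L₀) {S : Submodule ℝ L₀}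
    (K : Lie2Algebra L₁ S) : Prop where
  d_eq : ∀ f, (K.d f : L₀) = L.d f
  bracket₀_eq : ∀ x y : S, (K.bracket₀ x y : L₀) = L.bracket₀ x y
  bracket₁_eq : ∀ (x : S) f, K.bracket₁ x f = L.bracket₁ x f
  J_eq : ∀ x y z : S, K.J x y z = L.J x y z

noncomputable section

/-! ### Differential forms on a manifold

A `k`-form on the manifold `M` without boundary, modelled on `E`, is a family of alternating
`k`-linear forms on the tangent spaces. A `1`-form is also written as a family of linear forms. -/

section Forms

variable {E : Type*} [NormedAddCommGroup E] [NormedSpace ℝ E]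
  {M : Type*} [TopologicalSpace M] [ChartedSpace E M] {k : ℕ}

/-- The expression of a `k`-form in the chart at `x₀`: its pullback by the inverse of the chart. -/
def formInChart (η : Π x : M, TangentSpace 𝓘(ℝ, E) x [⋀^Fin k]→L[ℝ] ℝ) (x₀ : M) :
    E → E [⋀^Fin k]→L[ℝ] ℝ :=
  fun y ↦ (η ((extChartAt 𝓘(ℝ, E) x₀).symm y)).compContinuousLinearMap
    (mfderiv 𝓘(ℝ, E) 𝓘(ℝ, E) (extChartAt 𝓘(ℝ, E) x₀).symm y)

/-- A form is smooth if all its chart expressions are. -/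
def IsSmoothForm (η : Π x : M, TangentSpace 𝓘(ℝ, E) x [⋀^Fin k]→L[ℝ] ℝ) : Prop :=
  ∀ x₀ : M, ContDiffOn ℝ ∞ (formInChart η x₀) (extChartAt 𝓘(ℝ, E) x₀).target

/-- The exterior derivative, computed at `x` in the chart at `x`. -/
def mextDeriv (η : Π x : M, TangentSpace 𝓘(ℝ, E) x [⋀^Fin k]→L[ℝ] ℝ) (x : M) :
    TangentSpace 𝓘(ℝ, E) x [⋀^Fin (k + 1)]→L[ℝ] ℝ :=
  (extDeriv (formInChart η x) (extChartAt 𝓘(ℝ, E) x x)).compContinuousLinearMap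
    (mfderiv 𝓘(ℝ, E) 𝓘(ℝ, E) (extChartAt 𝓘(ℝ, E) x) x)

/-- A 2-plectic structure: a smooth closed nondegenerate `3`-form. -/
structure IsTwoPlectic (Ω : Π x : M, TangentSpace 𝓘(ℝ, E) x [⋀^Fin 3]→L[ℝ] ℝ) : Prop where
  smooth : IsSmoothForm Ω
  closed : ∀ x, mextDeriv Ω x = 0
  nondegenerate : ∀ (x : M) (v : TangentSpace 𝓘(ℝ, E) x), (∀ u w, Ω x ![v, u, w] = 0) → v = 0

/-- The exterior derivative of a function. -/
def funDeriv (f : M → ℝ) (x : M) : TangentSpace 𝓘(ℝ, E) x →L[ℝ] ℝ :=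
  mvfderiv 𝓘(ℝ, E) f x

/-- The exterior derivative of a `1`-form. -/
def oneFormDeriv (α : Π x : M, TangentSpace 𝓘(ℝ, E) x →L[ℝ] ℝ) (x : M) :
    TangentSpace 𝓘(ℝ, E) x [⋀^Fin 2]→L[ℝ] ℝ :=
  mextDeriv
    (fun y ↦ ContinuousAlternatingMap.ofSubsingleton ℝ (TangentSpace 𝓘(ℝ, E) y) ℝ (0 : Fin 1) (α y))
    x

/-- The interior product `ι_v η = η(v, ·)` of a `2`-form. -/
def interior₂ {x : M} (v : TangentSpace 𝓘(ℝ, E) x)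
    (η : TangentSpace 𝓘(ℝ, E) x [⋀^Fin 2]→L[ℝ] ℝ) : TangentSpace 𝓘(ℝ, E) x →L[ℝ] ℝ :=
  η.toContinuousMultilinearMap.toContinuousLinearMap ![v, 0] 1

/-- The iterated interior product `ι_w ι_v η = η(v, w, ·)` of a `3`-form. -/
def interior₃ {x : M} (w v : TangentSpace 𝓘(ℝ, E) x)
    (η : TangentSpace 𝓘(ℝ, E) x [⋀^Fin 3]→L[ℝ] ℝ) : TangentSpace 𝓘(ℝ, E) x →L[ℝ] ℝ :=
  η.toContinuousMultilinearMap.toContinuousLinearMap ![v, w, 0] 2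

theorem interior₂_apply {x : M} (v u : TangentSpace 𝓘(ℝ, E) x)
    (η : TangentSpace 𝓘(ℝ, E) x [⋀^Fin 2]→L[ℝ] ℝ) : interior₂ v η u = η ![v, u] := by
  have h : Function.update ![v, 0] 1 u = ![v, u] := by
    ext i; fin_cases i <;> simp
  simpa [interior₂] using congrArg η h

theorem interior₃_apply {x : M} (w v u : TangentSpace 𝓘(ℝ, E) x)
    (η : TangentSpace 𝓘(ℝ, E) x [⋀^Fin 3]→L[ℝ] ℝ) : interior₃ w v η u = η ![v, w, u] := by
  have h : Function.update ![v, w, 0] 2 u = ![v, w, u] := by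
    ext i; fin_cases i <;> simp
  simpa [interior₃] using congrArg η h

/-- The Lie derivative `L_v α = ι_v dα + d ι_v α` of a `1`-form along a vector field. -/
def lieDeriv (v : Π x : M, TangentSpace 𝓘(ℝ, E) x) (α : Π x : M, TangentSpace 𝓘(ℝ, E) x →L[ℝ] ℝ)
    (x : M) : TangentSpace 𝓘(ℝ, E) x →L[ℝ] ℝ :=
  interior₂ (v x) (oneFormDeriv α x) + funDeriv (fun y ↦ α y (v y)) x

end Forms

/-! ### The bundle `C`, its splitting and its brackets -/

section Courant

variable {E : Type*} [NormedAddCommGroup E] [NormedSpace ℝ E]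
  {M : Type*} [TopologicalSpace M] [ChartedSpace E M]
  {F : Type*} [NormedAddCommGroup F] [NormedSpace ℝ F]
  {C : M → Type*} [TopologicalSpace (TotalSpace F C)]
  [∀ x, TopologicalSpace (C x)] [∀ x, AddCommGroup (C x)] [∀ x, Module ℝ (C x)]
  [∀ x, IsTopologicalAddGroup (C x)] [∀ x, ContinuousSMul ℝ (C x)]
  [FiberBundle F C] [VectorBundle ℝ F C]

variable (E F C) in
/-- A smooth nondegenerate symmetric bilinear form `⟨·,·⟩` on the vector bundle `C → M` and a
smooth bundle map `ρ : C → TM`, the anchor. -/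
structure PairedAnchoredBundle [IsManifold 𝓘(ℝ, E) ∞ M] where
  /-- the bilinear form -/
  pairing : Π x : M, C x →L[ℝ] C x →L[ℝ] ℝ
  pairing_smooth : ContMDiff 𝓘(ℝ, E) (𝓘(ℝ, E).prod 𝓘(ℝ, F →L[ℝ] F →L[ℝ] ℝ)) ∞
    (fun x ↦ TotalSpace.mk' (F →L[ℝ] F →L[ℝ] ℝ) x (pairing x))
  pairing_symm : ∀ (x : M) (c c' : C x), pairing x c c' = pairing x c' c
  /-- nondegeneracy: the form identifies `C` with its dual bundle -/
  pairing_nondegenerate : ∀ x : M, Function.Bijective (pairing x)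
  /-- the anchor -/
  anchor : Π x : M, C x →L[ℝ] TangentSpace 𝓘(ℝ, E) x
  anchor_smooth : ContMDiff (𝓘(ℝ, E).prod 𝓘(ℝ, F)) (𝓘(ℝ, E).prod 𝓘(ℝ, E)) ∞
    (fun c : TotalSpace F C ↦ (⟨c.proj, anchor c.proj c.2⟩ : TangentBundle 𝓘(ℝ, E) M))

variable [IsManifold 𝓘(ℝ, E) ∞ M]

namespace PairedAnchoredBundle

variable (A : PairedAnchoredBundle E F C)

/-- The dual map `ρ* : T*M → C` of the anchor, where `C` is identified with its dual by the
bilinear form: `⟨ρ* α, c⟩ = α (ρ c)`. -/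
def anchorDual (x : M) (α : TangentSpace 𝓘(ℝ, E) x →L[ℝ] ℝ) : C x :=
  (Equiv.ofBijective _ (A.pairing_nondegenerate x)).symm (α.comp (A.anchor x))

theorem pairing_anchorDual (x : M) (α : TangentSpace 𝓘(ℝ, E) x →L[ℝ] ℝ) (c : C x) :
    A.pairing x (A.anchorDual x α) c = α (A.anchor x c) :=
  congrArg (fun β : C x →L[ℝ] ℝ ↦ β c)
    ((Equiv.ofBijective _ (A.pairing_nondegenerate x)).apply_symm_apply (α.comp (A.anchor x)))

/-- Exactness of `0 → T*M → C → TM → 0`, the maps being `ρ*` and `ρ`. -/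
structure IsExact : Prop where
  injective : ∀ x : M, Function.Injective (A.anchorDual x)
  exact : ∀ x : M, Function.Exact (A.anchorDual x) (A.anchor x)
  surjective : ∀ x : M, Function.Surjective (A.anchor x)

/-- The differential `D = ρ* d : C^∞(M) → Γ(C)`, as a map to sections. -/
def D (f : M → ℝ) (x : M) : C x := A.anchorDual x (funDeriv f x)

/-- A splitting: a smooth bundle map `s : TM → C` with `ρ ∘ s = id` and isotropic image. -/
structure Splitting where
  /-- the bundle map -/
  map : Π x : M, TangentSpace 𝓘(ℝ, E) x →L[ℝ] C x
  smooth : ContMDiff (𝓘(ℝ, E).prod 𝓘(ℝ, E)) (𝓘(ℝ, E).prod 𝓘(ℝ, F)) ∞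
    (fun v : TangentBundle 𝓘(ℝ, E) M ↦ (⟨v.proj, map v.proj v.2⟩ : TotalSpace F C))
  anchor_map : ∀ (x : M) (v : TangentSpace 𝓘(ℝ, E) x), A.anchor x (map x v) = v
  isotropic : ∀ (x : M) (v w : TangentSpace 𝓘(ℝ, E) x), A.pairing x (map x v) (map x w) = 0

/-- The vector field `v` of a section `e = s(v) + ρ* α`. -/
def vectorPart (e : Π x : M, C x) (x : M) : TangentSpace 𝓘(ℝ, E) x := A.anchor x (e x)

namespace Splitting

variable {A} (s : A.Splitting)

/-- The `1`-form `α` of a section `e = s(v) + ρ* α`. -/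
def formPart (e : Π x : M, C x) (x : M) : TangentSpace 𝓘(ℝ, E) x →L[ℝ] ℝ :=
  (A.pairing x (e x)).comp (s.map x)

/-- Every section is `s(v) + ρ* α` with `v = vectorPart e` and `α = formPart e`. -/
theorem decomposition (hA : A.IsExact) (e : Π x : M, C x) (x : M) :
    s.map x (A.vectorPart e x) + A.anchorDual x (s.formPart e x) = e x := by
  obtain ⟨β, hβ⟩ := (hA.exact x (e x - s.map x (A.anchor x (e x)))).1 (by
    simp [s.anchor_map])
  have h : s.formPart e x = β := by
    ext w
    have hw := A.pairing_anchorDual x β (s.map x w)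
    rw [hβ, s.anchor_map, map_sub, sub_apply, s.isotropic, sub_zero] at hw
    exact hw
  rw [h, hβ]
  simp [vectorPart]

variable (Ω : Π x : M, TangentSpace 𝓘(ℝ, E) x [⋀^Fin 3]→L[ℝ] ℝ)

/-- The twisted Courant bracket of `e₁ = s(v₁) + ρ* α₁` and `e₂ = s(v₂) + ρ* α₂`:
`s([v₁,v₂]) + ρ*(L_{v₁} α₂ - L_{v₂} α₁ - ½ d(ι_{v₁} α₂ - ι_{v₂} α₁) - ι_{v₂} ι_{v₁} Ω)`. -/
def courantBracket (e₁ e₂ : Π x : M, C x) (x : M) : C x :=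
  let v₁ := A.vectorPart e₁
  let v₂ := A.vectorPart e₂
  let α₁ := s.formPart e₁
  let α₂ := s.formPart e₂
  s.map x (VectorField.mlieBracket 𝓘(ℝ, E) v₁ v₂ x) +
    A.anchorDual x (lieDeriv v₁ α₂ x - lieDeriv v₂ α₁ x
      - (1 / 2 : ℝ) • funDeriv (fun y ↦ α₂ y (v₁ y) - α₁ y (v₂ y)) x
      - interior₃ (v₂ x) (v₁ x) (Ω x))

/-- The twisted Dorfman bracket of `e₁ = s(v₁) + ρ* α₁` and `e₂ = s(v₂) + ρ* α₂`:
`s([v₁,v₂]) + ρ*(L_{v₁} α₂ - ι_{v₂} dα₁ - ι_{v₂} ι_{v₁} Ω)`. -/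
def dorfmanBracket (e₁ e₂ : Π x : M, C x) (x : M) : C x :=
  let v₁ := A.vectorPart e₁
  let v₂ := A.vectorPart e₂
  let α₁ := s.formPart e₁
  let α₂ := s.formPart e₂
  s.map x (VectorField.mlieBracket 𝓘(ℝ, E) v₁ v₂ x) +
    A.anchorDual x (lieDeriv v₁ α₂ x - interior₂ (v₂ x) (oneFormDeriv α₁ x)
      - interior₃ (v₂ x) (v₁ x) (Ω x))

/-- `Γ(C)^s`: the smooth sections `e = s(v) + ρ* α` that preserve the splitting, that is, whose
twisted Dorfman bracket with `s(v')` is `s([v,v'])` for every smooth vector field `v'`. -/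
def preservingSections : Set (ContMDiffSection 𝓘(ℝ, E) F ∞ C) :=
  {e | ∀ v' : ContMDiffSection 𝓘(ℝ, E) E ∞ (TangentSpace 𝓘(ℝ, E) : M → Type _), ∀ x : M,
    s.dorfmanBracket Ω e (fun y ↦ s.map y (v' y)) x =
      s.map x (VectorField.mlieBracket 𝓘(ℝ, E) (A.vectorPart e) v' x)}

/-- The Lie 2-algebra structure `L` on `C^∞(M) → Γ(C)` is `L_∞(C)`: its differential is `D`, its
bracket is the twisted Courant bracket in degree `0` and `[e,f] = ½ ⟨e, D f⟩` in degree `1`, and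
its Jacobiator is
`J(e₁,e₂,e₃) = -⅙ (⟨[e₁,e₂],e₃⟩ + ⟨[e₃,e₁],e₂⟩ + ⟨[e₂,e₃],e₁⟩)`. -/
structure IsCourantLie2Algebra
    (L : Lie2Algebra (ContMDiffMap 𝓘(ℝ, E) 𝓘(ℝ, ℝ) M ℝ ∞) (ContMDiffSection 𝓘(ℝ, E) F ∞ C)) :
    Prop where
  d_eq : ∀ f x, L.d f x = A.D f x
  bracket₀_eq : ∀ e₁ e₂ x, L.bracket₀ e₁ e₂ x = s.courantBracket Ω e₁ e₂ x
  bracket₁_eq : ∀ e f x, L.bracket₁ e f x = (1 / 2 : ℝ) * A.pairing x (e x) (A.D f x)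
  J_eq : ∀ e₁ e₂ e₃ x, L.J e₁ e₂ e₃ x = -(1 / 6 : ℝ) *
    (A.pairing x (s.courantBracket Ω e₁ e₂ x) (e₃ x)
      + A.pairing x (s.courantBracket Ω e₃ e₁ x) (e₂ x)
      + A.pairing x (s.courantBracket Ω e₂ e₃ x) (e₁ x))

end Splitting

end PairedAnchoredBundle

end Courant

end

/-! The statement reduces to pure algebra. Let `V` be the Lie algebra of smooth vector fields and
`N` the `V`-module of smooth functions. A section `s(v) + ρ* α` is encoded by the pair `(v, α)`,
with `α` regarded only as an `ℝ`-linear map `V → N`. In these terms `L_v α` is the natural action on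
`Hom(V, N)`, `dα` is the Chevalley–Eilenberg differential, and `dΩ = 0` says that `Ω` is a
3-cocycle. The structure maps then make sense on `V ⊕ Hom(V, N)` for any Lie module with a
3-cocycle, and `cochainLie2Algebra` verifies the axioms there. In both the degree-0 homotopy
equation and the coherence law, the terms in the 1-forms cancel by the Jacobi identity and the
module law, and the terms in `Ω` are one instance of the cocycle identity.

The geometry is a transfer along `toCochain`, which is injective because every tangent vector
extends to a smooth vector field. The invariant formula `mextDeriv_apply_vectorField` and
`funDeriv_mlieBracket`, both proved in a chart, identify the differential operators on forms with
the algebraic ones. By `contMDiff_of_pairing`, brackets and differentials of smooth data are smooth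
sections, so `Lie2Algebra.comap` applies.

Since `s(v')` has zero 1-form, the Dorfman condition reads `ρ*(-ι_{v'} dα - ι_{v'} ι_v Ω) = 0`, and
`ρ*` is injective, so it means `dα = -ι_v Ω`. This linear condition holds for exact forms with `v =
0`, and it is stable under the bracket by Cartan calculus and closedness of `Ω`
(`cochainBracket_mem`). -/

/-! ### Restricting a Lie 2-algebra along an injective linear map -/

section Restriction

variable {L₁ L₀ L₀' : Type*} [AddCommGroup L₁] [Module ℝ L₁] [AddCommGroup L₀] [Module ℝ L₀]
  [AddCommGroup L₀'] [Module ℝ L₀']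

/-- The Lie 2-algebra induced on `L₀` by an injective linear map `i : L₀ → L₀'` whose image
contains the image of the differential and is closed under the bracket. -/
def Lie2Algebra.comap (L : Lie2Algebra L₁ L₀') (i : L₀ →ₗ[ℝ] L₀') (hi : Function.Injective i)
    (d : L₁ → L₀) (hd : ∀ f, i (d f) = L.d f)
    (b : L₀ → L₀ → L₀) (hb : ∀ x y, i (b x y) = L.bracket₀ (i x) (i y)) :
    Lie2Algebra L₁ L₀ where
  -- Linearity of `d` and of `b` is not assumed: it is forced by that of their images under the
  -- injective map `i`.
  d := { toFun := d
         map_add' := fun f g ↦ hi (by simp [hd])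
         map_smul' := fun c f ↦ hi (by simp [hd]) }
  bracket₀ := LinearMap.mk₂ ℝ b
    (fun x x' y ↦ hi (by simp [hb])) (fun c x y ↦ hi (by simp [hb]))
    (fun x y y' ↦ hi (by simp [hb])) (fun c x y ↦ hi (by simp [hb]))
  bracket₁ := L.bracket₁.comp i
  -- `compl₁₂` pulls back the first two arguments along `i`, and `lcomp` the third.
  J := (L.J.compl₁₂ i i).compr₂ (LinearMap.lcomp ℝ L₁ i)
  bracket_skew x y := hi (by simpa [hb] using L.bracket_skew (i x) (i y))
  d_bracket x f := hi (by simpa [hb, hd] using L.d_bracket (i x) f)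
  bracket_d f g := by simpa [hd] using L.bracket_d f g
  J_skew_left x y z := by simpa using L.J_skew_left (i x) (i y) (i z)
  J_skew_right x y z := by simpa using L.J_skew_right (i x) (i y) (i z)
  homotopy₀ x y z := hi (by simpa [hb, hd] using L.homotopy₀ (i x) (i y) (i z))
  homotopy₁ x y f := by simpa [hb, hd] using L.homotopy₁ (i x) (i y) f
  coherence x y z w := by simpa [hb] using L.coherence (i x) (i y) (i z) (i w)

end Restriction

/-! ### The Lie 2-algebra of a Lie module with a `3`-cocycle -/

noncomputable section LieModule

variable {V N : Type*} [LieRing V] [LieAlgebra ℝ V] [AddCommGroup N] [Module ℝ N]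
  [LieRingModule V N] [LieModule ℝ V N]

variable (V N) in
/-- The differential `n ↦ (w ↦ ⁅w, n⁆)` of the Chevalley–Eilenberg complex in degree `0`. -/
def lieCoboundary : N →ₗ[ℝ] V →ₗ[ℝ] N := (LieModule.toEnd ℝ V N : V →ₗ[ℝ] N →ₗ[ℝ] N).flip

@[simp] lemma lieCoboundary_apply (n : N) (w : V) : lieCoboundary V N n w = ⁅w, n⁆ := rfl

/-- A `3`-cocycle of the Lie algebra `V` with values in the module `N`. -/
structure IsLieThreeCocycle (Ω : V →ₗ[ℝ] V →ₗ[ℝ] V →ₗ[ℝ] N) : Prop where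
  skew_left : ∀ a b c, Ω a b c = -Ω b a c
  skew_right : ∀ a b c, Ω a b c = -Ω a c b
  closed : ∀ a b c d, ⁅a, Ω b c d⁆ - ⁅b, Ω a c d⁆ + ⁅c, Ω a b d⁆ - ⁅d, Ω a b c⁆
    - Ω ⁅a, b⁆ c d + Ω ⁅a, c⁆ b d - Ω ⁅a, d⁆ b c - Ω ⁅b, c⁆ a d + Ω ⁅b, d⁆ a c
    - Ω ⁅c, d⁆ a b = 0

/-- The symmetric pairing `⟨(v₁,α₁), (v₂,α₂)⟩ = α₁ v₂ + α₂ v₁`. -/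
def cochainPairing : V × (V →ₗ[ℝ] N) →ₗ[ℝ] V × (V →ₗ[ℝ] N) →ₗ[ℝ] N :=
  LinearMap.mk₂ ℝ (fun x y ↦ x.2 y.1 + y.2 x.1)
    (fun x x' y ↦ by simp; abel) (fun c x y ↦ by simp)
    (fun x y y' ↦ by simp; abel) (fun c x y ↦ by simp)

@[simp] lemma cochainPairing_apply (x y : V × (V →ₗ[ℝ] N)) :
    cochainPairing x y = x.2 y.1 + y.2 x.1 := rfl

/-- The twisted Courant bracket on `V ⊕ Hom(V, N)`. -/
def cochainBracket (Ω : V →ₗ[ℝ] V →ₗ[ℝ] V →ₗ[ℝ] N) :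
    V × (V →ₗ[ℝ] N) →ₗ[ℝ] V × (V →ₗ[ℝ] N) →ₗ[ℝ] V × (V →ₗ[ℝ] N) :=
  LinearMap.mk₂ ℝ (fun x y ↦ (⁅x.1, y.1⁆, ⁅x.1, y.2⁆ - ⁅y.1, x.2⁆
      - (1 / 2 : ℝ) • lieCoboundary V N (y.2 x.1 - x.2 y.1) - Ω x.1 y.1))
    (fun x x' y ↦ by ext <;> simp; module) (fun c x y ↦ by ext <;> simp; module)
    (fun x y y' ↦ by ext <;> simp; module) (fun c x y ↦ by ext <;> simp; module)

@[simp] lemma cochainBracket_fst (Ω : V →ₗ[ℝ] V →ₗ[ℝ] V →ₗ[ℝ] N) (x y : V × (V →ₗ[ℝ] N)) :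
    (cochainBracket Ω x y).1 = ⁅x.1, y.1⁆ := rfl

lemma cochainBracket_snd (Ω : V →ₗ[ℝ] V →ₗ[ℝ] V →ₗ[ℝ] N) (x y : V × (V →ₗ[ℝ] N)) (w : V) :
    (cochainBracket Ω x y).2 w = ⁅x.1, y.2 w⁆ - y.2 ⁅x.1, w⁆ - (⁅y.1, x.2 w⁆ - x.2 ⁅y.1, w⁆)
      - (1 / 2 : ℝ) • (⁅w, y.2 x.1⁆ - ⁅w, x.2 y.1⁆) - Ω x.1 y.1 w := by
  simp [cochainBracket]

/-- The Jacobiator on `V ⊕ Hom(V, N)`. -/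
def cochainJacobiator (Ω : V →ₗ[ℝ] V →ₗ[ℝ] V →ₗ[ℝ] N) :
    V × (V →ₗ[ℝ] N) →ₗ[ℝ] V × (V →ₗ[ℝ] N) →ₗ[ℝ] V × (V →ₗ[ℝ] N) →ₗ[ℝ] N :=
  LinearMap.mk₂ ℝ (fun x y ↦ -(1 / 6 : ℝ) • (cochainPairing (cochainBracket Ω x y)
      + (cochainPairing.flip y).comp ((cochainBracket Ω).flip x)
      + (cochainPairing.flip x).comp (cochainBracket Ω y)))
    (fun x x' y ↦ by
      ext z <;> simp only [map_add, LinearMap.comp_add, LinearMap.add_comp, LinearMap.add_apply,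
        LinearMap.smul_apply, LinearMap.comp_apply] <;> module)
    (fun c x y ↦ by
      ext z <;> simp only [map_smul, LinearMap.comp_smul, LinearMap.smul_comp,
        LinearMap.add_apply, LinearMap.smul_apply, LinearMap.comp_apply] <;> module)
    (fun x y y' ↦ by
      ext z <;> simp only [map_add, LinearMap.comp_add, LinearMap.add_comp, LinearMap.add_apply,
        LinearMap.smul_apply, LinearMap.comp_apply] <;> module)
    (fun c x y ↦ by
      ext z <;> simp only [map_smul, LinearMap.comp_smul, LinearMap.smul_comp,
        LinearMap.add_apply, LinearMap.smul_apply, LinearMap.comp_apply] <;> module)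

lemma cochainJacobiator_apply (Ω : V →ₗ[ℝ] V →ₗ[ℝ] V →ₗ[ℝ] N) (x y z : V × (V →ₗ[ℝ] N)) :
    cochainJacobiator Ω x y z = -(1 / 6 : ℝ) • (cochainPairing (cochainBracket Ω x y) z
      + cochainPairing (cochainBracket Ω z x) y + cochainPairing (cochainBracket Ω y z) x) := rfl

/-- Normal form in which every bracket of pairs has been expanded. The three pairings each
contribute `-Ω(x,y,z)`, hence the coefficient `½ = 3/6`. The remaining axioms are checked on this
form. -/
lemma cochainJacobiator_eq {Ω : V →ₗ[ℝ] V →ₗ[ℝ] V →ₗ[ℝ] N} (hΩ : IsLieThreeCocycle Ω)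
    (x y z : V × (V →ₗ[ℝ] N)) :
    cochainJacobiator Ω x y z = (1 / 2 : ℝ) • (Ω x.1 y.1 z.1
      - x.2 ⁅y.1, z.1⁆ - y.2 ⁅z.1, x.1⁆ - z.2 ⁅x.1, y.1⁆)
      + (1 / 4 : ℝ) • (⁅y.1, x.2 z.1⁆ - ⁅z.1, x.2 y.1⁆ + ⁅z.1, y.2 x.1⁆ - ⁅x.1, y.2 z.1⁆
        + ⁅x.1, z.2 y.1⁆ - ⁅y.1, z.2 x.1⁆) := by
  simp only [cochainJacobiator_apply, cochainPairing_apply, cochainBracket_snd, cochainBracket_fst]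
  rw [hΩ.skew_left z.1 x.1 y.1, hΩ.skew_right x.1 z.1 y.1, hΩ.skew_right y.1 z.1 x.1,
    hΩ.skew_left y.1 x.1 z.1, ← lie_skew x.1 z.1, ← lie_skew z.1 y.1, ← lie_skew y.1 x.1]
  simp only [map_neg]
  module

/-- The Lie 2-algebra `N → V ⊕ Hom(V, N)` of a Lie algebra `V`, a `V`-module `N` and a
`3`-cocycle. -/
def cochainLie2Algebra {Ω : V →ₗ[ℝ] V →ₗ[ℝ] V →ₗ[ℝ] N} (hΩ : IsLieThreeCocycle Ω) :
    Lie2Algebra N (V × (V →ₗ[ℝ] N)) where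
  d := (LinearMap.inr ℝ V (V →ₗ[ℝ] N)).comp (lieCoboundary V N)
  bracket₀ := cochainBracket Ω
  bracket₁ := (1 / 2 : ℝ) • ((LieModule.toEnd ℝ V N : V →ₗ[ℝ] N →ₗ[ℝ] N).comp
    (LinearMap.fst ℝ V (V →ₗ[ℝ] N)))
  J := cochainJacobiator Ω
  bracket_skew x y := by
    refine Prod.ext ?_ (LinearMap.ext fun w ↦ ?_)
    · simp
    · simp only [Prod.snd_neg, LinearMap.neg_apply, cochainBracket_snd]
      rw [hΩ.skew_left y.1 x.1]
      module
  d_bracket x f := by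
    refine Prod.ext ?_ (LinearMap.ext fun w ↦ ?_)
    · simp
    · simp [cochainBracket_snd]
      module
  bracket_d f g := by simp
  J_skew_left x y z := by
    rw [cochainJacobiator_eq hΩ, cochainJacobiator_eq hΩ, hΩ.skew_left y.1 x.1,
      ← lie_skew z.1 x.1, ← lie_skew x.1 y.1, ← lie_skew y.1 z.1]
    simp only [map_neg]
    module
  J_skew_right x y z := by
    rw [cochainJacobiator_eq hΩ, cochainJacobiator_eq hΩ, hΩ.skew_right x.1 z.1,
      ← lie_skew z.1 x.1, ← lie_skew x.1 y.1, ← lie_skew y.1 z.1]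
    simp only [map_neg]
    module
  homotopy₀ x y z := by
    refine Prod.ext ?_ (LinearMap.ext fun w ↦ ?_)
    · simp
    · obtain ⟨a, α⟩ := x
      obtain ⟨b, β⟩ := y
      obtain ⟨c, γ⟩ := z
      have cyc : ∀ u v w, Ω u v w = Ω w u v := fun u v w ↦ by
        rw [hΩ.skew_right, hΩ.skew_left, neg_neg]
      -- The form component of the differential of `n`, evaluated at `w`, is `⁅w, n⁆`.
      change _ = ⁅w, cochainJacobiator Ω (a, α) (b, β) (c, γ)⁆
      simp only [Prod.snd_sub, Prod.snd_add, LinearMap.sub_apply, LinearMap.add_apply,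
        cochainBracket_snd, cochainBracket_fst, cochainJacobiator_eq hΩ, lie_add, lie_sub,
        lie_smul, map_sub, lie_lie]
      -- From here on, brackets and arguments of `Ω` are put in a fixed order, so that `module` sees
      -- equal terms as equal; what remains is the cocycle identity at `a, b, c, w`.
      rw [← lie_skew b a, ← lie_skew c a, ← lie_skew c b]
      have h := hΩ.closed a b c w
      rw [← cyc b c ⁅a, w⁆, ← cyc a b ⁅c, w⁆, ← cyc a c ⁅b, w⁆, hΩ.skew_left ⁅b, c⁆,
        hΩ.skew_left ⁅a, c⁆] at h
      rw [cyc b c a, hΩ.skew_right a c b]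
      simp only [map_neg, lie_neg]
      linear_combination (norm := module) (-1 : ℝ) • h
  homotopy₁ x y f := by
    simp [cochainJacobiator_eq hΩ]
    module
  coherence x y z w := by
    obtain ⟨a, α⟩ := x
    obtain ⟨b, β⟩ := y
    obtain ⟨c, γ⟩ := z
    obtain ⟨d, δ⟩ := w
    simp only [cochainBracket_snd, cochainBracket_fst, cochainJacobiator_eq hΩ,
      LinearMap.comp_apply, LinearMap.smul_apply, LinearMap.fst_apply, LieHom.coe_toLinearMap,
      LieModule.toEnd_apply_apply, lie_sub, lie_smul, map_add, map_sub, map_smul, lie_lie]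
    rw [← lie_skew b a, ← lie_skew c a, ← lie_skew c b, ← lie_skew d a, ← lie_skew d b,
      ← lie_skew d c]
    have h := hΩ.closed a b c d
    have cyc : ∀ u v w, Ω u v w = Ω w u v := fun u v w ↦ by
      rw [hΩ.skew_right, hΩ.skew_left, neg_neg]
    have jac : ∀ u v w : V, ⁅w, ⁅u, v⁆⁆ = ⁅v, ⁅u, w⁆⁆ - ⁅u, ⁅v, w⁆⁆ := fun u v w ↦ by
      rw [← lie_skew w ⁅u, v⁆, lie_lie]; abel
    simp only [lie_neg, map_neg, smul_neg]
    -- The three iterated brackets of a triple satisfy the Jacobi relation; one of them is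
    -- eliminated for each of the four triples, leaving expressions that can be compared linearly.
    rw [jac a b c, jac a b d, jac a c d, jac b c d]
    simp only [map_sub]
    rw [cyc b c ⁅a, d⁆, cyc c d ⁅a, b⁆, cyc b d ⁅a, c⁆, cyc a b ⁅c, d⁆, cyc a d ⁅b, c⁆,
      cyc a c ⁅b, d⁆]
    rw [hΩ.skew_left a ⁅b, c⁆ d, hΩ.skew_left b ⁅a, c⁆ d]
    rw [cyc c d a, cyc c d b, cyc b d a, cyc b c a]
    rw [hΩ.skew_right a c b, hΩ.skew_right a d b, hΩ.skew_right a d c, hΩ.skew_right b d c]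
    simp only [lie_neg]
    linear_combination (norm := module) h

/-- The elements `(v, α)` with `dα = -ι_v Ω`. -/
def cochainPreserving (Ω : V →ₗ[ℝ] V →ₗ[ℝ] V →ₗ[ℝ] N) : Submodule ℝ (V × (V →ₗ[ℝ] N)) where
  carrier := {x | ∀ u w, ⁅u, x.2 w⁆ - ⁅w, x.2 u⁆ - x.2 ⁅u, w⁆ + Ω x.1 u w = 0}
  zero_mem' := by simp
  add_mem' {x y} hx hy u w := by
    have hx := hx u w
    have hy := hy u w
    change ⁅u, x.2 w + y.2 w⁆ - ⁅w, x.2 u + y.2 u⁆ - (x.2 ⁅u, w⁆ + y.2 ⁅u, w⁆)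
      + Ω (x.1 + y.1) u w = 0
    simp only [LinearMap.add_apply, lie_add, map_add]
    linear_combination (norm := module) hx + hy
  smul_mem' c x hx u w := by
    have hx := hx u w
    change ⁅u, c • x.2 w⁆ - ⁅w, c • x.2 u⁆ - c • x.2 ⁅u, w⁆ + Ω (c • x.1) u w = 0
    simp only [LinearMap.smul_apply, lie_smul, map_smul]
    linear_combination (norm := module) c • hx

lemma mem_cochainPreserving {Ω : V →ₗ[ℝ] V →ₗ[ℝ] V →ₗ[ℝ] N} {x : V × (V →ₗ[ℝ] N)} :
    x ∈ cochainPreserving Ω ↔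
      ∀ u w, ⁅u, x.2 w⁆ - ⁅w, x.2 u⁆ - x.2 ⁅u, w⁆ + Ω x.1 u w = 0 := Iff.rfl

/-- This is `d² = 0`, that is, the module law; the vector component is zero, so `Ω` does not enter.
-/
lemma cochainLie2Algebra_d_mem {Ω : V →ₗ[ℝ] V →ₗ[ℝ] V →ₗ[ℝ] N} (hΩ : IsLieThreeCocycle Ω)
    (n : N) : (cochainLie2Algebra hΩ).d n ∈ cochainPreserving Ω := by
  intro u w
  simp [cochainLie2Algebra]

/-- The exact term of the bracket is killed by `d`, so with `dα = -ι_a Ω` and `dβ = -ι_b Ω` the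
differential of its form part is `-L_a ι_b Ω + L_b ι_a Ω - d ι_b ι_a Ω`. By Cartan's formulas and
`dΩ = 0` this equals `-ι_{[a,b]} Ω`. -/
lemma cochainBracket_mem {Ω : V →ₗ[ℝ] V →ₗ[ℝ] V →ₗ[ℝ] N} (hΩ : IsLieThreeCocycle Ω)
    {x y : V × (V →ₗ[ℝ] N)} (hx : x ∈ cochainPreserving Ω) (hy : y ∈ cochainPreserving Ω) :
    cochainBracket Ω x y ∈ cochainPreserving Ω := by
  intro u w
  obtain ⟨a, α⟩ := x
  obtain ⟨b, β⟩ := y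
  rw [mem_cochainPreserving] at hx hy
  have h := hΩ.closed a b u w
  -- The combination `h₃ - h₁ - h₂` is `L_b (dα + ι_a Ω) = 0` evaluated at `u, w`; likewise the
  -- `k`'s give `L_a (dβ + ι_b Ω) = 0`.
  have h₁ := hx ⁅b, u⁆ w
  have h₂ := hx u ⁅b, w⁆
  have h₃ := congrArg (⁅b, ·⁆) (hx u w)
  have k₁ := hy ⁅a, u⁆ w
  have k₂ := hy u ⁅a, w⁆
  have k₃ := congrArg (⁅a, ·⁆) (hy u w)
  simp only [cochainBracket_snd, cochainBracket_fst, lie_add, lie_sub, lie_smul, map_sub,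
    lie_lie, lie_zero] at *
  have cyc : ∀ p q r, Ω p q r = Ω r p q := fun p q r ↦ by
    rw [hΩ.skew_right, hΩ.skew_left, neg_neg]
  rw [hΩ.skew_left ⁅a, u⁆ b w, hΩ.skew_left ⁅b, u⁆ a w, ← cyc b u ⁅a, w⁆, ← cyc a u ⁅b, w⁆,
    ← cyc a b ⁅u, w⁆] at h
  linear_combination (norm := module) k₃ - k₁ - k₂ - (h₃ - h₁ - h₂) - h

end LieModule

/-! ### Exterior derivative and Lie bracket computed in charts. -/

noncomputable section

section FormCalculus

variable {E : Type*} [NormedAddCommGroup E] [NormedSpace ℝ E] [FiniteDimensional ℝ E]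
  {M : Type*} [TopologicalSpace M] [ChartedSpace E M] [IsManifold 𝓘(ℝ, E) ∞ M] {k : ℕ}

lemma isManifold_of_infty (n : ℕ∞) : IsManifold 𝓘(ℝ, E) n M :=
  IsManifold.of_le (n := ∞) (by exact_mod_cast le_top)

lemma funDeriv_apply_eq_fderiv {f : M → ℝ} {x : M} (hf : MDifferentiableAt 𝓘(ℝ, E) 𝓘(ℝ, ℝ) f x)
    (v : TangentSpace 𝓘(ℝ, E) x) :
    funDeriv f x v = fderiv ℝ (f ∘ (extChartAt 𝓘(ℝ, E) x).symm) (extChartAt 𝓘(ℝ, E) x x) v := by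
  have h := hf.mvfderiv
  simp only [modelWithCornersSelf_coe, range_id, fderivWithin_univ] at h
  exact congrArg (fun L ↦ L v) h

/-- The expression of a vector field in the chart at `x`. -/
def vectorFieldInChart (V : Π x : M, TangentSpace 𝓘(ℝ, E) x) (x : M) : E → E :=
  fun y ↦ (mfderiv 𝓘(ℝ, E) 𝓘(ℝ, E) (extChartAt 𝓘(ℝ, E) x).symm y).inverse
    (V ((extChartAt 𝓘(ℝ, E) x).symm y))

/-- The tangent space at `x` is identified with `E` through the chart at `x`, so the derivative of
this chart at its centre is the identity. -/
lemma vectorFieldInChart_self (V : Π x : M, TangentSpace 𝓘(ℝ, E) x) (x : M) :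
    vectorFieldInChart V x (extChartAt 𝓘(ℝ, E) x x) = V x := by
  have := isManifold_of_infty (E := E) (M := M) 1
  have h := mfderivWithin_range_extChartAt_symm (I := 𝓘(ℝ, E)) (x := x)
  simp only [modelWithCornersSelf_coe, range_id, mfderivWithin_univ] at h
  -- The point `φ⁻¹(φ x)` equals `x` only propositionally and the type of `V` depends on it;
  -- generalizing both the point and the derivative allows substitution.
  have h2 : ∀ p, p = x → ∀ L : E →L[ℝ] E, L = .id ℝ E → L.inverse (V p : E) = V x := by
    rintro _ rfl _ rfl
    rw [ContinuousLinearMap.inverse_id]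
    rfl
  exact h2 _ (extChartAt_to_inv x) _ h

lemma mlieBracket_eq_lieBracket_inChart (V W : Π x : M, TangentSpace 𝓘(ℝ, E) x) (x : M) :
    VectorField.mlieBracket 𝓘(ℝ, E) V W x =
      VectorField.lieBracket ℝ (vectorFieldInChart V x) (vectorFieldInChart W x)
        (extChartAt 𝓘(ℝ, E) x x) := by
  have := isManifold_of_infty (E := E) (M := M) 1
  have h : ∀ L : E →L[ℝ] E, L = .id ℝ E → ∀ u, L.inverse u = u := by
    rintro _ rfl u
    rw [ContinuousLinearMap.inverse_id]
    rfl
  rw [← VectorField.mlieBracketWithin_univ, VectorField.mlieBracketWithin_apply]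
  simp only [modelWithCornersSelf_coe, range_id, preimage_univ, inter_univ,
    VectorField.mpullbackWithin_univ]
  exact (h _ mfderiv_extChartAt_self _).trans (congrFun VectorField.lieBracketWithin_univ _)

lemma differentiableAt_vectorFieldInChart {V : Π x : M, TangentSpace 𝓘(ℝ, E) x} {x : M}
    (hV : MDifferentiableAt 𝓘(ℝ, E) (𝓘(ℝ, E).prod 𝓘(ℝ, E))
      (fun y ↦ (⟨y, V y⟩ : TangentBundle 𝓘(ℝ, E) M)) x) :
    DifferentiableAt ℝ (vectorFieldInChart V x) (extChartAt 𝓘(ℝ, E) x x) := by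
  have := isManifold_of_infty (E := E) (M := M) 2
  have : CompleteSpace E := FiniteDimensional.complete ℝ E
  rw [← mdifferentiableWithinAt_univ] at hV
  have h := hV.differentiableWithinAt_mpullbackWithin_vectorField
  simp only [modelWithCornersSelf_coe, range_id, preimage_univ, inter_univ,
    VectorField.mpullbackWithin_univ] at h
  exact differentiableWithinAt_univ.1 h

lemma formInChart_self (η : Π x : M, TangentSpace 𝓘(ℝ, E) x [⋀^Fin k]→L[ℝ] ℝ) (x : M)
    (u : Fin k → E) : formInChart η x (extChartAt 𝓘(ℝ, E) x x) u = η x u := by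
  have := isManifold_of_infty (E := E) (M := M) 1
  have h := mfderivWithin_range_extChartAt_symm (I := 𝓘(ℝ, E)) (x := x)
  simp only [modelWithCornersSelf_coe, range_id, mfderivWithin_univ] at h
  have h2 : ∀ p, p = x → ∀ L : E →L[ℝ] E, L = .id ℝ E →
      η p (fun i ↦ (L (u i) : E)) = η x u := by
    rintro _ rfl _ rfl
    rfl
  exact h2 _ (extChartAt_to_inv x) _ h

lemma formInChart_vectorFieldInChart (η : Π x : M, TangentSpace 𝓘(ℝ, E) x [⋀^Fin k]→L[ℝ] ℝ) (x : M)
    (V : Fin k → Π x : M, TangentSpace 𝓘(ℝ, E) x) {y : E}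
    (hy : y ∈ (extChartAt 𝓘(ℝ, E) x).target) :
    formInChart η x y (fun i ↦ vectorFieldInChart (V i) x y) =
      η ((extChartAt 𝓘(ℝ, E) x).symm y) (fun i ↦ V i ((extChartAt 𝓘(ℝ, E) x).symm y)) := by
  have := isManifold_of_infty (E := E) (M := M) 1
  have h := isInvertible_mfderivWithin_extChartAt_symm hy
  simp only [modelWithCornersSelf_coe, range_id, mfderivWithin_univ] at h
  obtain ⟨e, he⟩ := h
  refine congrArg (η _) (funext fun i ↦ ?_)
  simp only [vectorFieldInChart, ← he, ContinuousLinearMap.inverse_equiv]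
  exact e.apply_symm_apply _

lemma mfderiv_extChartAt_self_apply (x : M) (v : TangentSpace 𝓘(ℝ, E) x) :
    mfderiv 𝓘(ℝ, E) 𝓘(ℝ, E) (extChartAt 𝓘(ℝ, E) x) x v = v := by
  have := isManifold_of_infty (E := E) (M := M) 1
  rw [mfderiv_extChartAt_self]
  rfl

/-- The invariant formula for the exterior derivative. -/
lemma mextDeriv_apply_vectorField (η : Π x : M, TangentSpace 𝓘(ℝ, E) x [⋀^Fin (k + 1)]→L[ℝ] ℝ)
    {x : M} (hη : DifferentiableAt ℝ (formInChart η x) (extChartAt 𝓘(ℝ, E) x x))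
    (V : Fin (k + 2) → Π x : M, TangentSpace 𝓘(ℝ, E) x)
    (hV : ∀ i, MDifferentiableAt 𝓘(ℝ, E) (𝓘(ℝ, E).prod 𝓘(ℝ, E))
      (fun y ↦ (⟨y, V i y⟩ : TangentBundle 𝓘(ℝ, E) M)) x)
    (hηV : ∀ i : Fin (k + 2), MDifferentiableAt 𝓘(ℝ, E) 𝓘(ℝ, ℝ)
      (fun y ↦ η y (i.removeNth fun j ↦ V j y)) x) :
    mextDeriv η x (fun i ↦ V i x) =
      (∑ i, (-1) ^ i.val • funDeriv (fun y ↦ η y (i.removeNth fun j ↦ V j y)) x (V i x)) -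
        ∑ i : Fin (k + 1), ∑ j ≥ i, (-1) ^ (i + j : ℕ) •
          η x (Matrix.vecCons (VectorField.mlieBracket 𝓘(ℝ, E) (V i.castSucc) (V j.succ) x)
            (j.removeNth <| i.castSucc.removeNth fun l ↦ V l x)) := by
  have key := extDeriv_apply_vectorField hη
    (V := fun i ↦ vectorFieldInChart (V i) x) fun i ↦ differentiableAt_vectorFieldInChart (hV i)
  simp only [vectorFieldInChart_self, formInChart_self] at key
  have h1 : mextDeriv η x (fun i ↦ V i x) =
      extDeriv (formInChart η x) (extChartAt 𝓘(ℝ, E) x x) (fun i ↦ V i x) :=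
    congrArg (extDeriv (formInChart η x) (extChartAt 𝓘(ℝ, E) x x))
      (funext fun i ↦ mfderiv_extChartAt_self_apply x (V i x))
  rw [h1]
  refine key.trans ?_
  congr 1
  · refine Finset.sum_congr rfl fun i _ ↦ ?_
    rw [funDeriv_apply_eq_fderiv (hηV i)]
    congr 2
    -- The chart expression of the function agrees with it only on the target of the chart, which
    -- suffices for the derivative at the centre.
    refine Filter.EventuallyEq.fderiv_eq ?_
    filter_upwards [(isOpen_extChartAt_target x).mem_nhds (mem_extChartAt_target x)] with y hy
    exact formInChart_vectorFieldInChart η x (fun l ↦ V (i.succAbove l)) hy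
  · simp only [mlieBracket_eq_lieBracket_inChart]
    rfl

/-- In a chart, the derivative of `W f` along `V` is `dg(DW·V) + D²g(V, W)`. The second-order terms
of the two summands cancel by symmetry of `D²g`, leaving `dg` of the Lie bracket. -/
lemma funDeriv_mlieBracket {f : M → ℝ} (hf : ContMDiff 𝓘(ℝ, E) 𝓘(ℝ, ℝ) ∞ f)
    {V W : Π x : M, TangentSpace 𝓘(ℝ, E) x} {x : M}
    (hV : MDifferentiableAt 𝓘(ℝ, E) (𝓘(ℝ, E).prod 𝓘(ℝ, E))
      (fun y ↦ (⟨y, V y⟩ : TangentBundle 𝓘(ℝ, E) M)) x)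
    (hW : MDifferentiableAt 𝓘(ℝ, E) (𝓘(ℝ, E).prod 𝓘(ℝ, E))
      (fun y ↦ (⟨y, W y⟩ : TangentBundle 𝓘(ℝ, E) M)) x)
    (hVf : MDifferentiableAt 𝓘(ℝ, E) 𝓘(ℝ, ℝ) (fun y ↦ funDeriv f y (V y)) x)
    (hWf : MDifferentiableAt 𝓘(ℝ, E) 𝓘(ℝ, ℝ) (fun y ↦ funDeriv f y (W y)) x) :
    funDeriv f x (VectorField.mlieBracket 𝓘(ℝ, E) V W x) =
      funDeriv (fun y ↦ funDeriv f y (W y)) x (V x)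
        - funDeriv (fun y ↦ funDeriv f y (V y)) x (W x) := by
  have := isManifold_of_infty (E := E) (M := M) 1
  set φ := extChartAt 𝓘(ℝ, E) x
  set g : E → ℝ := f ∘ φ.symm
  have hg : ContDiffAt ℝ ∞ g (φ x) := by
    rw [← contMDiffAt_iff_contDiffAt]
    exact hf.contMDiffAt.comp _ ((contMDiffOn_extChartAt_symm x).contMDiffAt
      ((isOpen_extChartAt_target x).mem_nhds (mem_extChartAt_target x)))
  have h2 : (2 : WithTop ℕ∞) ≤ ∞ := WithTop.coe_le_coe.2 (le_top : (2 : ℕ∞) ≤ ⊤)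
  have hdg : DifferentiableAt ℝ (fderiv ℝ g) (φ x) :=
    (hg.fderiv_right (m := 1) (by simpa [one_add_one_eq_two] using h2)).differentiableAt one_ne_zero
  have hsymm := hg.isSymmSndFDerivAt (by simpa using h2)
  have hloc : ∀ U : Π x : M, TangentSpace 𝓘(ℝ, E) x, ∀ᶠ y in 𝓝 (φ x),
      funDeriv f (φ.symm y) (U (φ.symm y)) = fderiv ℝ g y (vectorFieldInChart U x y) := by
    intro U
    filter_upwards [(isOpen_extChartAt_target x).mem_nhds (mem_extChartAt_target x)] with y hy
    have hψ : MDifferentiableAt 𝓘(ℝ, E) 𝓘(ℝ, E) φ.symm y :=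
      (contMDiffOn_extChartAt_symm (n := ∞) x).contMDiffAt
        ((isOpen_extChartAt_target x).mem_nhds hy) |>.mdifferentiableAt (by simp)
    have h (u : E) : fderiv ℝ g y u =
        mfderiv 𝓘(ℝ, E) 𝓘(ℝ, ℝ) f (φ.symm y) (mfderiv 𝓘(ℝ, E) 𝓘(ℝ, E) φ.symm y u) := by
      rw [← mfderiv_eq_fderiv]
      exact DFunLike.congr_fun
        (mfderiv_comp y (hf.mdifferentiableAt (by simp) (x := φ.symm y)) hψ) u
    have hinv := isInvertible_mfderivWithin_extChartAt_symm hy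
    simp only [modelWithCornersSelf_coe, range_id, mfderivWithin_univ] at hinv
    have hU : mfderiv 𝓘(ℝ, E) 𝓘(ℝ, E) φ.symm y (vectorFieldInChart (E := E) U x y) =
        U (φ.symm y) := by
      obtain ⟨e, he⟩ := hinv
      simp only [vectorFieldInChart, ← he, ContinuousLinearMap.inverse_equiv, φ]
      exact e.apply_symm_apply _
    rw [h]
    exact congrArg (funDeriv f (φ.symm y)) hU.symm
  have hder : ∀ {U : Π x : M, TangentSpace 𝓘(ℝ, E) x},
      MDifferentiableAt 𝓘(ℝ, E) 𝓘(ℝ, ℝ) (fun y ↦ funDeriv f y (U y)) x →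
      MDifferentiableAt 𝓘(ℝ, E) (𝓘(ℝ, E).prod 𝓘(ℝ, E))
        (fun y ↦ (⟨y, U y⟩ : TangentBundle 𝓘(ℝ, E) M)) x → ∀ u : TangentSpace 𝓘(ℝ, E) x,
      funDeriv (fun y ↦ funDeriv f y (U y)) x u =
        fderiv ℝ g (φ x) (fderiv ℝ (vectorFieldInChart U x) (φ x) u)
          + fderiv ℝ (fderiv ℝ g) (φ x) u (U x) := by
    intro U hUf hU u
    rw [funDeriv_apply_eq_fderiv hUf]
    refine (DFunLike.congr_fun (Filter.EventuallyEq.fderiv_eq (𝕜 := ℝ) (hloc U)) u).trans ?_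
    rw [fderiv_clm_apply hdg (differentiableAt_vectorFieldInChart hU),
      vectorFieldInChart_self]
    rfl
  rw [hder hVf hV, hder hWf hW, mlieBracket_eq_lieBracket_inChart]
  refine (funDeriv_apply_eq_fderiv (hf.mdifferentiableAt (by simp))
    (VectorField.lieBracket (E := E) ℝ _ _ _)).trans ?_
  rw [VectorField.lieBracket, vectorFieldInChart_self, vectorFieldInChart_self, map_sub]
  have := hsymm (V x) (W x)
  simp only [φ, g] at this ⊢
  linarith

variable (E M) in
/-- The smooth vector fields on `M`. -/
abbrev SmoothVectorField : Type _ :=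
  ContMDiffSection 𝓘(ℝ, E) E ∞ (TangentSpace 𝓘(ℝ, E) : M → Type _)

lemma SmoothVectorField.mdifferentiableAt (V : SmoothVectorField E M) (x : M) :
    MDifferentiableAt 𝓘(ℝ, E) (𝓘(ℝ, E).prod 𝓘(ℝ, E))
      (fun y ↦ (⟨y, V y⟩ : TangentBundle 𝓘(ℝ, E) M)) x :=
  (V.contMDiff x).mdifferentiableAt (by simp)

/-- The function `df(V)` is the fibre component of the tangent map of `f` composed with `V`. -/
lemma contMDiff_funDeriv_apply {f : M → ℝ} (hf : ContMDiff 𝓘(ℝ, E) 𝓘(ℝ, ℝ) ∞ f)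
    {V : Π x : M, TangentSpace 𝓘(ℝ, E) x}
    (hV : ContMDiff 𝓘(ℝ, E) (𝓘(ℝ, E).prod 𝓘(ℝ, E)) ∞
      (fun y ↦ (⟨y, V y⟩ : TangentBundle 𝓘(ℝ, E) M))) :
    ContMDiff 𝓘(ℝ, E) 𝓘(ℝ, ℝ) ∞ (fun y ↦ funDeriv f y (V y)) :=
  (contMDiff_snd_tangentBundle_modelSpace ℝ 𝓘(ℝ, ℝ)).comp
    ((hf.contMDiff_tangentMap (m := ∞) le_rfl).comp hV)

end FormCalculus

/-! ### Smoothness tested on smooth sections. -/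

section Smoothness

variable {E : Type*} [NormedAddCommGroup E] [NormedSpace ℝ E] [FiniteDimensional ℝ E]
  {M : Type*} [TopologicalSpace M] [T2Space M] [ChartedSpace E M] [IsManifold 𝓘(ℝ, E) ∞ M]

/-- A family of linear maps on a finite-dimensional space is smooth if its values are. -/
lemma contMDiffAt_clm_of_apply {F H : Type*} [NormedAddCommGroup F] [NormedSpace ℝ F]
    [FiniteDimensional ℝ F] [NormedAddCommGroup H] [NormedSpace ℝ H] {G : M → F →L[ℝ] H} {x : M}
    (h : ∀ v, ContMDiffAt 𝓘(ℝ, E) 𝓘(ℝ, H) ∞ (fun y ↦ G y v) x) :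
    ContMDiffAt 𝓘(ℝ, E) 𝓘(ℝ, F →L[ℝ] H) ∞ G x := by
  let b := Module.finBasis ℝ F
  have hG : G = fun y ↦ ∑ i, ContinuousLinearMap.smulRightL ℝ F H
      (LinearMap.toContinuousLinearMap (b.coord i)) (G y (b i)) := by
    ext y v
    conv_lhs => rw [← b.sum_repr v, map_sum]
    simp
  rw [hG]
  refine ContMDiffAt.sum fun i _ ↦ ?_
  exact (ContinuousLinearMap.contMDiff _).contMDiffAt.comp x (h (b i))

section Bundle

variable {F : Type*} [NormedAddCommGroup F] [NormedSpace ℝ F]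
  {C : M → Type*} [TopologicalSpace (TotalSpace F C)]
  [∀ x, TopologicalSpace (C x)] [∀ x, AddCommGroup (C x)] [∀ x, Module ℝ (C x)]
  [FiberBundle F C] [VectorBundle ℝ F C]

/-- Multiply the constant local section by a bump function supported in the base set of the
trivialization and equal to `1` near `x`. -/
lemma exists_contMDiffSection_eventuallyEq_symmL [ContMDiffVectorBundle ∞ F C 𝓘(ℝ, E)] (x : M)
    (v : F) : ∃ σ : ContMDiffSection 𝓘(ℝ, E) F ∞ C,
      ∀ᶠ y in 𝓝 x, σ y = (trivializationAt F C x).symmL ℝ y v := by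
  set t := trivializationAt F C x
  have ht : t.baseSet ∈ 𝓝 x :=
    t.open_baseSet.mem_nhds (FiberBundle.mem_baseSet_trivializationAt' x)
  obtain ⟨ψ, -, hψ⟩ := (SmoothBumpFunction.nhds_basis_tsupport (I := 𝓘(ℝ, E)) x).mem_iff.1 ht
  have hs : ContMDiffOn 𝓘(ℝ, E) (𝓘(ℝ, E).prod 𝓘(ℝ, F)) ∞
      (fun y ↦ TotalSpace.mk' F y (t.symm y v)) t.baseSet := by
    intro y hy
    rw [t.contMDiffWithinAt_section _ hy]
    have h : ContMDiffOn 𝓘(ℝ, E) 𝓘(ℝ, F) ∞ (fun _ : M ↦ v) t.baseSet := contMDiffOn_const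
    exact h.congr (fun z hz ↦ by simp [hz]) y hy
  refine ⟨⟨_, ψ.contMDiff.contMDiffOn.smul_section_of_tsupport t.open_baseSet hψ hs⟩, ?_⟩
  filter_upwards [ψ.eventuallyEq_one, ht] with y hy hyt
  simpa [hy] using (t.symmL_apply (R := ℝ) hyt v).symm

lemma exists_contMDiffSection_apply_eq [ContMDiffVectorBundle ∞ F C 𝓘(ℝ, E)] {x : M} (c : C x) :
    ∃ σ : ContMDiffSection 𝓘(ℝ, E) F ∞ C, σ x = c := by
  obtain ⟨σ, hσ⟩ := exists_contMDiffSection_eventuallyEq_symmL (E := E) (C := C) x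
    (trivializationAt F C x ⟨x, c⟩).2
  have hx := FiberBundle.mem_baseSet_trivializationAt' (F := F) (E := C) x
  exact ⟨σ, by simp [Trivialization.symmL_apply _ hx, hσ.self_of_nhds, hx]⟩

/-- A section of a bundle with a nondegenerate form is smooth if its products with smooth sections
are. -/
lemma contMDiff_of_pairing [FiniteDimensional ℝ F] [ContMDiffVectorBundle ∞ F C 𝓘(ℝ, E)]
    (g : Π x : M, C x →L[ℝ] C x →L[ℝ] ℝ)
    (hg : ∀ σ τ : ContMDiffSection 𝓘(ℝ, E) F ∞ C,
      ContMDiff 𝓘(ℝ, E) 𝓘(ℝ, ℝ) ∞ (fun y ↦ g y (σ y) (τ y)))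
    (hb : ∀ x, Function.Injective (g x)) {c : Π x : M, C x}
    (hc : ∀ σ : ContMDiffSection 𝓘(ℝ, E) F ∞ C,
      ContMDiff 𝓘(ℝ, E) 𝓘(ℝ, ℝ) ∞ (fun y ↦ g y (c y) (σ y))) :
    ContMDiff 𝓘(ℝ, E) (𝓘(ℝ, E).prod 𝓘(ℝ, F)) ∞ (fun y ↦ TotalSpace.mk' F y (c y)) := by
  intro x
  have : CompleteSpace F := FiniteDimensional.complete ℝ F
  set t := trivializationAt F C x
  have hx : x ∈ t.baseSet := FiberBundle.mem_baseSet_trivializationAt' x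
  have ht : t.baseSet ∈ 𝓝 x := t.open_baseSet.mem_nhds hx
  -- In the trivialization, `B` is the Gram form and `ℓ` the functional paired with `c`. The
  -- coordinates of `c` are `B⁻¹ ℓ`, and inversion of linear maps is smooth.
  let ℓ : M → F →L[ℝ] ℝ := fun y ↦ (g y (c y)).comp (t.symmL ℝ y)
  let B : M → F →L[ℝ] F →L[ℝ] ℝ := fun y ↦ ((t.symmL ℝ y).precomp ℝ ∘L g y) ∘L t.symmL ℝ y
  have hℓ : ContMDiffAt 𝓘(ℝ, E) 𝓘(ℝ, F →L[ℝ] ℝ) ∞ ℓ x := by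
    refine contMDiffAt_clm_of_apply fun v ↦ ?_
    obtain ⟨σ, hσ⟩ := exists_contMDiffSection_eventuallyEq_symmL (E := E) (F := F) (C := C) x v
    refine (hc σ x).congr_of_eventuallyEq ?_
    filter_upwards [hσ] with y hy
    rw [hy]
    rfl
  have hB : ContMDiffAt 𝓘(ℝ, E) 𝓘(ℝ, F →L[ℝ] F →L[ℝ] ℝ) ∞ B x := by
    refine contMDiffAt_clm_of_apply fun v ↦ contMDiffAt_clm_of_apply fun w ↦ ?_
    obtain ⟨σ, hσ⟩ := exists_contMDiffSection_eventuallyEq_symmL (E := E) (F := F) (C := C) x v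
    obtain ⟨τ, hτ⟩ := exists_contMDiffSection_eventuallyEq_symmL (E := E) (F := F) (C := C) x w
    refine (hg σ τ x).congr_of_eventuallyEq ?_
    filter_upwards [hσ, hτ] with y hy hy'
    rw [hy, hy']
    rfl
  have hBinv : ∀ y ∈ t.baseSet, ∃ e : F ≃L[ℝ] (F →L[ℝ] ℝ), (e : F →L[ℝ] F →L[ℝ] ℝ) = B y := by
    intro y hy
    have hinj : Function.Injective (B y) := by
      rw [injective_iff_map_eq_zero]
      intro v hv
      have h0 : t.symmL ℝ y v = 0 := by
        refine (injective_iff_map_eq_zero (g y)).1 (hb y) _ ?_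
        ext d
        have hd : g y (t.symmL ℝ y v) (t.symmL ℝ y (t.continuousLinearMapAt ℝ y d)) = 0 :=
          DFunLike.congr_fun hv (t.continuousLinearMapAt ℝ y d)
        rwa [t.symmL_continuousLinearMapAt hy] at hd
      have := congrArg (t.continuousLinearMapAt ℝ y) h0
      simpa [t.continuousLinearMapAt_symmL hy] using this
    -- An injective map from `F` to its dual is invertible by dimension.
    have hdim : Module.finrank ℝ F = Module.finrank ℝ (F →L[ℝ] ℝ) := by
      rw [← LinearMap.toContinuousLinearMap.finrank_eq (M := F →ₗ[ℝ] ℝ)]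
      exact (Subspace.dual_finrank_eq (K := ℝ) (V := F)).symm
    exact ⟨(LinearEquiv.ofInjectiveOfFinrankEq (B y : F →ₗ[ℝ] F →L[ℝ] ℝ) hinj
      hdim).toContinuousLinearEquiv, by ext; rfl⟩
  rw [contMDiffAt_section]
  obtain ⟨e, he⟩ := hBinv x hx
  have hinv : ContMDiffAt 𝓘(ℝ, E) 𝓘(ℝ, (F →L[ℝ] ℝ) →L[ℝ] F) ∞ (fun y ↦ (B y).inverse) x := by
    refine ContMDiffAt.comp x (g := ContinuousLinearMap.inverse) ?_ hB
    rw [← he]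
    exact (contDiffAt_map_inverse e).contMDiffAt
  refine (hinv.clm_apply hℓ).congr_of_eventuallyEq ?_
  filter_upwards [ht] with y hy
  obtain ⟨e, he⟩ := hBinv y hy
  have h1 : ℓ y = B y (t ⟨y, c y⟩).2 := by
    ext v
    simp [ℓ, B, hy]
  rw [h1, ← he, ContinuousLinearMap.inverse_equiv]
  exact (e.symm_apply_apply _).symm

end Bundle

/-- If a `1`-form has smooth values on smooth vector fields, then its chart expressions are
differentiable. -/
lemma differentiableAt_formInChart_of_apply {α : Π x : M, TangentSpace 𝓘(ℝ, E) x →L[ℝ] ℝ}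
    (hα : ∀ V : SmoothVectorField E M, ContMDiff 𝓘(ℝ, E) 𝓘(ℝ, ℝ) ∞ (fun y ↦ α y (V y))) (x : M) :
    DifferentiableAt ℝ (formInChart (fun y ↦ ContinuousAlternatingMap.ofSubsingleton ℝ
      (TangentSpace 𝓘(ℝ, E) y) ℝ (0 : Fin 1) (α y)) x) (extChartAt 𝓘(ℝ, E) x x) := by
  have := isManifold_of_infty (E := E) (M := M) 1
  set φ := extChartAt 𝓘(ℝ, E) x
  -- The coefficients of `α` in the coordinate frame, as a function on `M`. Near `x` each frame
  -- field is the germ of a global smooth field, so the hypothesis applies.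
  let ℓ : M → E →L[ℝ] ℝ := fun p ↦ (α p).comp (mfderiv 𝓘(ℝ, E) 𝓘(ℝ, E) φ.symm (φ p))
  have hℓ : ContMDiffAt 𝓘(ℝ, E) 𝓘(ℝ, E →L[ℝ] ℝ) ∞ ℓ x := by
    refine contMDiffAt_clm_of_apply fun v ↦ ?_
    obtain ⟨σ, hσ⟩ := exists_contMDiffSection_eventuallyEq_symmL (E := E)
      (C := (TangentSpace 𝓘(ℝ, E) : M → Type _)) x v
    refine (hα σ x).congr_of_eventuallyEq ?_
    filter_upwards [hσ, (chartAt E x).open_source.mem_nhds (mem_chart_source E x)] with y hy hys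
    have h := TangentBundle.symmL_trivializationAt (I := 𝓘(ℝ, E)) hys
    simp only [modelWithCornersSelf_coe, range_id, mfderivWithin_univ] at h
    rw [hy]
    exact congrArg (α y) (DFunLike.congr_fun h v).symm
  have hψ : ContMDiffAt 𝓘(ℝ, E) 𝓘(ℝ, E) ∞ φ.symm (φ x) :=
    (contMDiffOn_extChartAt_symm x).contMDiffAt
      ((isOpen_extChartAt_target x).mem_nhds (mem_extChartAt_target x))
  have h1 : DifferentiableAt ℝ (ℓ ∘ φ.symm) (φ x) := by
    rw [← mdifferentiableAt_iff_differentiableAt]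
    refine MDifferentiableAt.comp _ ?_ (hψ.mdifferentiableAt (by simp))
    rw [extChartAt_to_inv x]
    exact hℓ.mdifferentiableAt (by simp)
  have h2 := ((ContinuousAlternatingMap.ofSubsingletonLIE (𝕜 := ℝ) (E := E) (F := ℝ)
    (0 : Fin 1)).differentiable (ℓ (φ.symm (φ x)))).comp (φ x) h1
  refine h2.congr_of_eventuallyEq ?_
  filter_upwards [(isOpen_extChartAt_target x).mem_nhds (mem_extChartAt_target x)] with y hy
  ext u
  simp only [formInChart, Function.comp_apply, ℓ]
  rw [φ.right_inv hy]
  rfl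

/-- Evaluation is linear in the form and multilinear in the vectors. -/
lemma contDiff_continuousAlternatingMap_apply (k : ℕ) :
    ContDiff ℝ ∞ (fun p : (E [⋀^Fin k]→L[ℝ] ℝ) × (Fin k → E) ↦ p.1 p.2) := by
  let m : ContinuousMultilinearMap ℝ (fun _ : Fin k ↦ E) ((E [⋀^Fin k]→L[ℝ] ℝ) →L[ℝ] ℝ) :=
    (ContinuousAlternatingMap.toContinuousMultilinearMapCLM ℝ).flipMultilinear
  have h := ContinuousMultilinearMap.contDiff (𝕜 := ℝ) (E := fun _ : Fin k ↦ E)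
    (F := (E [⋀^Fin k]→L[ℝ] ℝ) →L[ℝ] ℝ) (n := ∞) m
  exact (h.comp contDiff_snd).clm_apply contDiff_fst

lemma IsSmoothForm.contMDiff_apply {k : ℕ} {η : Π x : M, TangentSpace 𝓘(ℝ, E) x [⋀^Fin k]→L[ℝ] ℝ}
    (hη : IsSmoothForm η) (V : Fin k → SmoothVectorField E M) :
    ContMDiff 𝓘(ℝ, E) 𝓘(ℝ, ℝ) ∞ (fun y ↦ η y (fun i ↦ V i y)) := by
  intro x
  have := isManifold_of_infty (E := E) (M := M) 1
  set φ := extChartAt 𝓘(ℝ, E) x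
  have h1 : ContMDiffAt 𝓘(ℝ, E) 𝓘(ℝ, E [⋀^Fin k]→L[ℝ] ℝ) ∞ (formInChart η x ∘ φ) x :=
    ((hη x).contDiffAt ((isOpen_extChartAt_target x).mem_nhds
      (mem_extChartAt_target x))).contMDiffAt.comp x contMDiffAt_extChartAt
  have h2 : ContMDiffAt 𝓘(ℝ, E) 𝓘(ℝ, Fin k → E) ∞
      (fun y i ↦ (trivializationAt E (TangentSpace 𝓘(ℝ, E)) x ⟨y, V i y⟩).2) x := by
    rw [contMDiffAt_pi_space]
    intro i
    exact (contMDiffAt_section _).1 ((V i).contMDiff x)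
  refine ((contDiff_continuousAlternatingMap_apply k).contMDiff.contMDiffAt.comp x
    (h1.prodMk_space h2)).congr_of_eventuallyEq ?_
  filter_upwards [(chartAt E x).open_source.mem_nhds (mem_chart_source E x)] with y hy
  have hy' : y ∈ φ.source := by simpa [φ] using hy
  -- The two coordinate descriptions of a vector field agree: the inverse of the tangent
  -- trivialization is the derivative of the inverse chart.
  have h3 (i) : (trivializationAt E (TangentSpace 𝓘(ℝ, E)) x ⟨y, V i y⟩).2 =
      vectorFieldInChart (V i) x (φ y) := by
    set t := trivializationAt E (TangentSpace 𝓘(ℝ, E) : M → Type _) x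
    have hyt : y ∈ t.baseSet := by simpa [t] using hy
    have h := TangentBundle.symmL_trivializationAt (I := 𝓘(ℝ, E)) hy
    simp only [modelWithCornersSelf_coe, range_id, mfderivWithin_univ] at h
    have h4 : ∀ p, p = y → ∀ L : E →L[ℝ] E, L = t.symmL ℝ y →
        L.inverse (V i p) = (t ⟨y, V i y⟩).2 := by
      intro p hp L hL
      subst hp hL
      have h5 := t.symm_continuousLinearEquivAt_eq' (R := ℝ) hyt
      refine (congrArg (fun L : E →L[ℝ] TangentSpace 𝓘(ℝ, E) p ↦
        L.inverse (V i p)) h5).symm.trans ?_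
      rw [ContinuousLinearMap.inverse_equiv]
      rfl
    exact (h4 _ (φ.left_inv hy') _ h.symm).symm
  refine Eq.trans ?_ (congrArg (formInChart η x (φ y)) (funext fun i ↦ h3 i)).symm
  rw [formInChart_vectorFieldInChart η x (fun i ↦ V i) (φ.map_source hy')]
  change _ = η (φ.symm (φ y)) _
  rw [φ.left_inv hy']

end Smoothness

/-! ### The Lie algebra of vector fields and its module of functions. -/

section VectorFields

variable {E : Type*} [NormedAddCommGroup E] [NormedSpace ℝ E] [FiniteDimensional ℝ E]
  {M : Type*} [TopologicalSpace M] [ChartedSpace E M] [IsManifold 𝓘(ℝ, E) ∞ M]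

variable (E M) in
/-- The smooth functions on `M`. -/
abbrev SmoothFunction : Type _ := ContMDiffMap 𝓘(ℝ, E) 𝓘(ℝ, ℝ) M ℝ ∞

lemma SmoothFunction.mdifferentiableAt (f : SmoothFunction E M) (x : M) :
    MDifferentiableAt 𝓘(ℝ, E) 𝓘(ℝ, ℝ) f x :=
  f.contMDiff.mdifferentiableAt (by simp)

lemma contMDiff_mlieBracket (V W : SmoothVectorField E M) :
    ContMDiff 𝓘(ℝ, E) (𝓘(ℝ, E).prod 𝓘(ℝ, E)) ∞ (fun x ↦
      (⟨x, VectorField.mlieBracket 𝓘(ℝ, E) V W x⟩ : TangentBundle 𝓘(ℝ, E) M)) := by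
  have : CompleteSpace E := FiniteDimensional.complete ℝ E
  have : IsManifold 𝓘(ℝ, E) (minSmoothness ℝ 3) M := by simpa using isManifold_of_infty 3
  have : IsManifold 𝓘(ℝ, E) ((⊤ : ℕ∞) + 1) M := by simpa
  exact ContDiff.mlieBracket_vectorField (m := ⊤) (n := ⊤) V.contMDiff W.contMDiff (by simp)

instance : Bracket (SmoothVectorField E M) (SmoothVectorField E M) :=
  ⟨fun V W ↦ ⟨VectorField.mlieBracket 𝓘(ℝ, E) V W, contMDiff_mlieBracket V W⟩⟩

instance : LieRing (SmoothVectorField E M) where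
  add_lie U V W := by
    have := isManifold_of_infty (E := E) (M := M) 2
    have : CompleteSpace E := FiniteDimensional.complete ℝ E
    ext x
    exact VectorField.mlieBracket_add_left (U.mdifferentiableAt x) (V.mdifferentiableAt x)
  lie_add U V W := by
    have := isManifold_of_infty (E := E) (M := M) 2
    have : CompleteSpace E := FiniteDimensional.complete ℝ E
    ext x
    exact VectorField.mlieBracket_add_right (V.mdifferentiableAt x) (W.mdifferentiableAt x)
  lie_self V := by
    ext x
    exact congrFun VectorField.mlieBracket_self x
  leibniz_lie U V W := by
    have : CompleteSpace E := FiniteDimensional.complete ℝ E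
    have : IsManifold 𝓘(ℝ, E) (minSmoothness ℝ 3) M := by simpa using isManifold_of_infty 3
    have h : minSmoothness ℝ 2 ≤ ∞ := by
      simpa using (WithTop.coe_le_coe.2 (le_top : (2 : ℕ∞) ≤ ⊤))
    ext x
    exact VectorField.leibniz_identity_mlieBracket_apply ((U.contMDiff x).of_le h)
      ((V.contMDiff x).of_le h) ((W.contMDiff x).of_le h)

instance : LieAlgebra ℝ (SmoothVectorField E M) where
  lie_smul c V W := by
    have := isManifold_of_infty (E := E) (M := M) 2
    have : CompleteSpace E := FiniteDimensional.complete ℝ E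
    ext x
    exact VectorField.mlieBracket_const_smul_right (W.mdifferentiableAt x)

instance : Bracket (SmoothVectorField E M) (SmoothFunction E M) :=
  ⟨fun V f ↦ ⟨fun x ↦ funDeriv f x (V x), contMDiff_funDeriv_apply f.contMDiff V.contMDiff⟩⟩

instance : LieRingModule (SmoothVectorField E M) (SmoothFunction E M) where
  add_lie V W f := by
    ext x
    exact map_add (funDeriv f x) (V x) (W x)
  lie_add V f g := by
    ext x
    exact DFunLike.congr_fun (mvfderiv_add (f.mdifferentiableAt x) (g.mdifferentiableAt x)) (V x)
  leibniz_lie V W f := by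
    ext x
    have h := funDeriv_mlieBracket f.contMDiff (V.mdifferentiableAt x) (W.mdifferentiableAt x)
      (SmoothFunction.mdifferentiableAt ⁅V, f⁆ x) (SmoothFunction.mdifferentiableAt ⁅W, f⁆ x)
    exact (eq_sub_iff_add_eq.1 h).symm

instance : LieModule ℝ (SmoothVectorField E M) (SmoothFunction E M) where
  smul_lie c V f := by
    ext x
    exact map_smul (funDeriv f x) c (V x)
  lie_smul c V f := by
    ext x
    have h := mvfderiv_smul (mdifferentiableAt_const (c := c)) (f.mdifferentiableAt x)
    have h2 := DFunLike.congr_fun h (V x)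
    rw [mvfderiv_const] at h2
    refine h2.trans ?_
    simp
    exact Or.inl rfl

end VectorFields

/-! ### Differential forms as Chevalley–Eilenberg cochains. -/

section Forms

variable {E : Type*} [NormedAddCommGroup E] [NormedSpace ℝ E] [FiniteDimensional ℝ E]
  {M : Type*} [TopologicalSpace M] [T2Space M] [ChartedSpace E M] [IsManifold 𝓘(ℝ, E) ∞ M]

lemma Fin.removeNth_fin_two {X : Type*} (u : Fin 2 → X) :
    Fin.removeNth 0 u = ![u 1] ∧ Fin.removeNth 1 u = ![u 0] := by
  refine ⟨?_, ?_⟩ <;> funext i <;> fin_cases i <;> rfl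

lemma Fin.removeNth_fin_three {X : Type*} (u : Fin 3 → X) :
    Fin.removeNth 0 u = ![u 1, u 2] ∧ Fin.removeNth 1 u = ![u 0, u 2] ∧
      Fin.removeNth 2 u = ![u 0, u 1] := by
  refine ⟨?_, ?_, ?_⟩ <;> funext i <;> fin_cases i <;> rfl

lemma Fin.removeNth_fin_four {X : Type*} (u : Fin 4 → X) :
    Fin.removeNth 0 u = ![u 1, u 2, u 3] ∧ Fin.removeNth 1 u = ![u 0, u 2, u 3] ∧
      Fin.removeNth 2 u = ![u 0, u 1, u 3] ∧ Fin.removeNth 3 u = ![u 0, u 1, u 2] := by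
  refine ⟨?_, ?_, ?_, ?_⟩ <;> funext i <;> fin_cases i <;> rfl

/-- The invariant formula in its lowest degree. Smooth values on smooth fields suffice as
regularity, which is exactly what a cochain records. -/
lemma oneFormDeriv_apply_vectorField {α : Π x : M, TangentSpace 𝓘(ℝ, E) x →L[ℝ] ℝ}
    (hα : ∀ V : SmoothVectorField E M, ContMDiff 𝓘(ℝ, E) 𝓘(ℝ, ℝ) ∞ (fun y ↦ α y (V y)))
    (V W : SmoothVectorField E M) (x : M) :
    oneFormDeriv α x ![V x, W x] = funDeriv (fun y ↦ α y (W y)) x (V x)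
      - funDeriv (fun y ↦ α y (V y)) x (W x) - α x (⁅V, W⁆ x) := by
  have h := mextDeriv_apply_vectorField (fun y ↦ ContinuousAlternatingMap.ofSubsingleton ℝ
      (TangentSpace 𝓘(ℝ, E) y) ℝ (0 : Fin 1) (α y)) (differentiableAt_formInChart_of_apply hα x)
    (fun i ↦ ![V, W] i) (by simp [Fin.forall_fin_two, V.mdifferentiableAt, W.mdifferentiableAt])
    (Fin.forall_fin_two.2 ⟨(hα W).mdifferentiableAt (by simp),
      (hα V).mdifferentiableAt (by simp)⟩)
  have h1 : (fun i ↦ ![V, W] i x) = ![V x, W x] := by funext i; fin_cases i <;> rfl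
  rw [oneFormDeriv, ← h1, h]
  simp [Fin.sum_univ_two, Fin.removeNth_fin_two, -Fin.removeNth_zero]
  rfl

variable {Ω : Π x : M, TangentSpace 𝓘(ℝ, E) x [⋀^Fin 3]→L[ℝ] ℝ}

lemma threeForm_skew_left {x : M} (η : TangentSpace 𝓘(ℝ, E) x [⋀^Fin 3]→L[ℝ] ℝ)
    (a b c : TangentSpace 𝓘(ℝ, E) x) : η ![a, b, c] = -η ![b, a, c] := by
  rw [← η.coe_toAlternatingMap, ← η.toAlternatingMap.map_swap ![b, a, c] (i := 0) (j := 1)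
    (by decide)]
  congr 1
  ext i; fin_cases i <;> rfl

lemma threeForm_skew_right {x : M} (η : TangentSpace 𝓘(ℝ, E) x [⋀^Fin 3]→L[ℝ] ℝ)
    (a b c : TangentSpace 𝓘(ℝ, E) x) : η ![a, b, c] = -η ![a, c, b] := by
  rw [← η.coe_toAlternatingMap, ← η.toAlternatingMap.map_swap ![a, c, b] (i := 1) (j := 2)
    (by decide)]
  congr 1
  ext i; fin_cases i <;> rfl

lemma threeForm_add_right {x : M} (η : TangentSpace 𝓘(ℝ, E) x [⋀^Fin 3]→L[ℝ] ℝ)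
    (a b c d : TangentSpace 𝓘(ℝ, E) x) : η ![a, b, c + d] = η ![a, b, c] + η ![a, b, d] := by
  simp only [← interior₃_apply, map_add]

lemma threeForm_smul_right {x : M} (η : TangentSpace 𝓘(ℝ, E) x [⋀^Fin 3]→L[ℝ] ℝ)
    (a b c : TangentSpace 𝓘(ℝ, E) x) (r : ℝ) : η ![a, b, r • c] = r * η ![a, b, c] := by
  simp only [← interior₃_apply, map_smul, smul_eq_mul]

/-- A smooth `3`-form as a trilinear map on vector fields. -/
def IsSmoothForm.trilinear (hΩ : IsSmoothForm Ω) : SmoothVectorField E M →ₗ[ℝ]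
    SmoothVectorField E M →ₗ[ℝ] SmoothVectorField E M →ₗ[ℝ] SmoothFunction E M :=
  LinearMap.mk₂ ℝ (fun U V ↦
    { toFun := fun W ↦ ⟨fun x ↦ Ω x ![U x, V x, W x], by
        refine (hΩ.contMDiff_apply ![U, V, W]).congr fun x ↦ congrArg (Ω x) ?_
        ext i; fin_cases i <;> rfl⟩
      map_add' := fun W W' ↦ by
        ext x
        exact threeForm_add_right (Ω x) _ _ _ _
      map_smul' := fun c W ↦ by
        ext x
        exact threeForm_smul_right (Ω x) _ _ _ _ })
    (fun U U' V ↦ by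
      ext W x
      change Ω x ![U x + U' x, V x, W x] = Ω x ![U x, V x, W x] + Ω x ![U' x, V x, W x]
      -- Additivity is available in the last slot, through the interior product; transpositions
      -- carry the first slot there and back.
      rw [threeForm_skew_left, threeForm_skew_right, threeForm_add_right,
        threeForm_skew_left _ (U x), threeForm_skew_right _ _ (U x),
        threeForm_skew_left _ (U' x), threeForm_skew_right _ _ (U' x)]
      ring)
    (fun c U V ↦ by
      ext W x
      change Ω x ![c • U x, V x, W x] = c * Ω x ![U x, V x, W x]
      rw [threeForm_skew_left, threeForm_skew_right, threeForm_smul_right,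
        threeForm_skew_left _ (U x), threeForm_skew_right _ _ (U x)]
      ring)
    (fun U V V' ↦ by
      ext W x
      change Ω x ![U x, V x + V' x, W x] = Ω x ![U x, V x, W x] + Ω x ![U x, V' x, W x]
      rw [threeForm_skew_right, threeForm_add_right, threeForm_skew_right _ _ (V x),
        threeForm_skew_right _ _ (V' x)]
      ring)
    (fun c U V ↦ by
      ext W x
      change Ω x ![U x, c • V x, W x] = c * Ω x ![U x, V x, W x]
      rw [threeForm_skew_right, threeForm_smul_right, threeForm_skew_right _ _ (V x)]
      ring)

/-- The invariant formula for `dΩ` on four vector fields is, term by term, the cocycle identity. -/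
lemma IsTwoPlectic.isLieThreeCocycle (hΩ : IsTwoPlectic Ω) :
    IsLieThreeCocycle hΩ.smooth.trilinear where
  skew_left U V W := by
    ext x
    exact threeForm_skew_left _ _ _ _
  skew_right U V W := by
    ext x
    exact threeForm_skew_right _ _ _ _
  closed a b c d := by
    ext x
    have h := mextDeriv_apply_vectorField Ω
      (((hΩ.smooth x).contDiffAt ((isOpen_extChartAt_target x).mem_nhds
        (mem_extChartAt_target x))).differentiableAt (by simp))
      (fun i ↦ ![a, b, c, d] i) (fun i ↦ SmoothVectorField.mdifferentiableAt _ x)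
      (fun i ↦ (hΩ.smooth.contMDiff_apply
        (fun j ↦ ![a, b, c, d] (i.succAbove j))).mdifferentiableAt (by simp))
    rw [hΩ.closed] at h
    -- The ranges `j ≥ i` of the inner sum over pairs in the invariant formula.
    have e1 : Finset.Ici (1 : Fin 3) = {1, 2} := by decide
    have e2 : Finset.Ici (2 : Fin 3) = {2} := by decide
    simp [Fin.sum_univ_succ, Fin.removeNth_fin_three, Fin.removeNth_fin_four, e1, e2,
      -Fin.removeNth_zero] at h
    change funDeriv (fun y ↦ Ω y ![b y, c y, d y]) x (a x)
      - funDeriv (fun y ↦ Ω y ![a y, c y, d y]) x (b x)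
      + funDeriv (fun y ↦ Ω y ![a y, b y, d y]) x (c x)
      - funDeriv (fun y ↦ Ω y ![a y, b y, c y]) x (d x)
      - Ω x ![VectorField.mlieBracket 𝓘(ℝ, E) a b x, c x, d x]
      + Ω x ![VectorField.mlieBracket 𝓘(ℝ, E) a c x, b x, d x]
      - Ω x ![VectorField.mlieBracket 𝓘(ℝ, E) a d x, b x, c x]
      - Ω x ![VectorField.mlieBracket 𝓘(ℝ, E) b c x, a x, d x]
      + Ω x ![VectorField.mlieBracket 𝓘(ℝ, E) b d x, a x, c x]
      - Ω x ![VectorField.mlieBracket 𝓘(ℝ, E) c d x, a x, b x] = 0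
    linarith

end Forms

/-! ### Transfer of the algebraic structure to sections of `C`. -/

section Courant

variable {E : Type*} [NormedAddCommGroup E] [NormedSpace ℝ E] [FiniteDimensional ℝ E]
  {M : Type*} [TopologicalSpace M] [T2Space M] [ChartedSpace E M] [IsManifold 𝓘(ℝ, E) ∞ M]

/-- Tensoriality of a covector: it is determined by its values on smooth vector fields. -/
lemma covector_ext {x : M} {α β : TangentSpace 𝓘(ℝ, E) x →L[ℝ] ℝ}
    (h : ∀ W : SmoothVectorField E M, α (W x) = β (W x)) : α = β := by
  ext w
  obtain ⟨W, rfl⟩ := exists_contMDiffSection_apply_eq (E := E) (F := E)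
    (C := (TangentSpace 𝓘(ℝ, E) : M → Type _)) w
  exact h W

/-- The term `d(ι_V α)(W)` in Cartan's formula cancels a term of `dα(V, W)`. What remains is the
natural action of a Lie algebra on `Hom(V, N)`. -/
lemma lieDeriv_apply_vectorField {α : Π x : M, TangentSpace 𝓘(ℝ, E) x →L[ℝ] ℝ}
    (hα : ∀ V : SmoothVectorField E M, ContMDiff 𝓘(ℝ, E) 𝓘(ℝ, ℝ) ∞ (fun y ↦ α y (V y)))
    (V W : SmoothVectorField E M) (x : M) :
    lieDeriv V α x (W x) = funDeriv (fun y ↦ α y (W y)) x (V x) - α x (⁅V, W⁆ x) := by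
  rw [lieDeriv, add_apply, interior₂_apply, oneFormDeriv_apply_vectorField hα]
  ring

lemma lieDeriv_zero (V : SmoothVectorField E M) (x : M) :
    lieDeriv V (fun y ↦ (0 : TangentSpace 𝓘(ℝ, E) y →L[ℝ] ℝ)) x = 0 := by
  refine covector_ext fun W ↦ ?_
  rw [lieDeriv_apply_vectorField (fun _ ↦ contMDiff_const)]
  have h : funDeriv (fun _ : M ↦ (0 : ℝ)) x (V x) = 0 :=
    DFunLike.congr_fun (mvfderiv_const (I := 𝓘(ℝ, E)) (c := (0 : ℝ)) (x := x)) (V x)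
  exact (congrArg (· - (0 : ℝ)) h).trans (sub_zero 0)

variable {F : Type*} [NormedAddCommGroup F] [NormedSpace ℝ F] [FiniteDimensional ℝ F]
  {C : M → Type*} [TopologicalSpace (TotalSpace F C)]
  [∀ x, TopologicalSpace (C x)] [∀ x, AddCommGroup (C x)] [∀ x, Module ℝ (C x)]
  [∀ x, IsTopologicalAddGroup (C x)] [∀ x, ContinuousSMul ℝ (C x)]
  [FiberBundle F C] [VectorBundle ℝ F C] [ContMDiffVectorBundle ∞ F C 𝓘(ℝ, E)]

namespace PairedAnchoredBundle

variable (A : PairedAnchoredBundle E F C)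

lemma contMDiff_pairing (σ τ : ContMDiffSection 𝓘(ℝ, E) F ∞ C) :
    ContMDiff 𝓘(ℝ, E) 𝓘(ℝ, ℝ) ∞ (fun y ↦ A.pairing y (σ y) (τ y)) := by
  -- Applying a smooth section of a Hom-bundle yields a section of the trivial line bundle; its
  -- fibre component is the desired function.
  have h : ContMDiff 𝓘(ℝ, E) (𝓘(ℝ, E).prod 𝓘(ℝ, ℝ)) ∞
      (fun y ↦ TotalSpace.mk' ℝ (E := Bundle.Trivial M ℝ) y (A.pairing y (σ y) (τ y))) := by
    intro x
    exact ContMDiffAt.clm_bundle_apply₂ (F₁ := F) (F₂ := F) (A.pairing_smooth x) (σ.contMDiff x)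
      (τ.contMDiff x)
  intro x
  have hx := h x
  simp only [contMDiffAt_totalSpace] at hx
  exact hx.2

/-- The vector field of a smooth section, as a smooth vector field. -/
def vectorField (e : ContMDiffSection 𝓘(ℝ, E) F ∞ C) : SmoothVectorField E M :=
  ⟨A.vectorPart e, A.anchor_smooth.comp e.contMDiff⟩

variable {A} in
lemma IsExact.anchor_anchorDual (hA : A.IsExact) (x : M) (α : TangentSpace 𝓘(ℝ, E) x →L[ℝ] ℝ) :
    A.anchor x (A.anchorDual x α) = 0 :=
  (hA.exact x _).2 ⟨α, rfl⟩

lemma anchorDual_eq_zero_iff {x : M} {α : TangentSpace 𝓘(ℝ, E) x →L[ℝ] ℝ} (hA : A.IsExact) :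
    A.anchorDual x α = 0 ↔ α = 0 := by
  have h : A.anchorDual x 0 = 0 := (A.pairing_nondegenerate x).1 (by
    ext c
    rw [pairing_anchorDual]
    simp)
  exact ⟨fun hα ↦ hA.injective x (hα.trans h.symm), fun hα ↦ hα ▸ h⟩

namespace Splitting

variable {A} (s : A.Splitting)

lemma anchor_map_add_anchorDual (hA : A.IsExact) (x : M) (v : TangentSpace 𝓘(ℝ, E) x)
    (α : TangentSpace 𝓘(ℝ, E) x →L[ℝ] ℝ) :
    A.anchor x (s.map x v + A.anchorDual x α) = v := by
  rw [map_add, s.anchor_map, hA.anchor_anchorDual, add_zero]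

lemma pairing_map_add_anchorDual (x : M) (v w : TangentSpace 𝓘(ℝ, E) x)
    (α : TangentSpace 𝓘(ℝ, E) x →L[ℝ] ℝ) :
    A.pairing x (s.map x v + A.anchorDual x α) (s.map x w) = α w := by
  rw [map_add, add_apply, s.isotropic, pairing_anchorDual, s.anchor_map, zero_add]

/-- Only `c` needs to be decomposed: `ρ* α` pairs with `c'` through the anchor, and `s(v)` pairs
with `c'` by the definition of `formPart`. -/
lemma pairing_eq (hA : A.IsExact) (c c' : Π x : M, C x) (x : M) :
    A.pairing x (c x) (c' x) =
      s.formPart c x (A.vectorPart c' x) + s.formPart c' x (A.vectorPart c x) := by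
  conv_lhs => rw [← s.decomposition hA c x]
  rw [map_add, add_apply, pairing_anchorDual, A.pairing_symm, add_comm]
  rfl

lemma contMDiff_formPart_apply (e : ContMDiffSection 𝓘(ℝ, E) F ∞ C) (V : SmoothVectorField E M) :
    ContMDiff 𝓘(ℝ, E) 𝓘(ℝ, ℝ) ∞ (fun y ↦ s.formPart e y (V y)) :=
  A.contMDiff_pairing e ⟨fun y ↦ s.map y (V y), s.smooth.comp V.contMDiff⟩

/-- A section is smooth if its vector field and its `1`-form are. -/
lemma contMDiff_of_parts (hA : A.IsExact) {c : Π x : M, C x} (V : SmoothVectorField E M)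
    (hV : A.vectorPart c = V) (hc : ∀ W : SmoothVectorField E M,
      ContMDiff 𝓘(ℝ, E) 𝓘(ℝ, ℝ) ∞ (fun y ↦ s.formPart c y (W y))) :
    ContMDiff 𝓘(ℝ, E) (𝓘(ℝ, E).prod 𝓘(ℝ, F)) ∞ (fun y ↦ TotalSpace.mk' F y (c y)) := by
  refine contMDiff_of_pairing A.pairing A.contMDiff_pairing
    (fun x ↦ (A.pairing_nondegenerate x).1) fun σ ↦ ?_
  simp only [s.pairing_eq hA c σ, hV]
  exact (hc (A.vectorField σ)).add (s.contMDiff_formPart_apply σ V)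

/-- The decomposition of a section into its vector field and its `1`-form, the latter acting on
vector fields. -/
def toCochain : ContMDiffSection 𝓘(ℝ, E) F ∞ C →ₗ[ℝ]
    SmoothVectorField E M × (SmoothVectorField E M →ₗ[ℝ] SmoothFunction E M) where
  toFun e := (A.vectorField e,
    { toFun := fun V ↦ ⟨fun x ↦ s.formPart e x (V x), s.contMDiff_formPart_apply e V⟩
      map_add' := fun V W ↦ by
        ext x
        exact map_add (s.formPart e x) (V x) (W x)
      map_smul' := fun c V ↦ by
        ext x
        exact map_smul (s.formPart e x) c (V x) })
  map_add' e e' := by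
    refine Prod.ext ?_ ?_
    · ext x
      exact map_add (A.anchor x) (e x) (e' x)
    · ext V x
      exact DFunLike.congr_fun (map_add (A.pairing x) (e x) (e' x)) (s.map x (V x))
  map_smul' c e := by
    refine Prod.ext ?_ ?_
    · ext x
      exact map_smul (A.anchor x) c (e x)
    · ext V x
      exact DFunLike.congr_fun (map_smul (A.pairing x) c (e x)) (s.map x (V x))

lemma toCochain_injective (hA : A.IsExact) : Function.Injective s.toCochain := by
  intro e e' h
  ext x
  have h1 : A.vectorPart e x = A.vectorPart e' x := DFunLike.congr_fun (congrArg Prod.fst h) x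
  have h2 : s.formPart e x = s.formPart e' x := covector_ext fun W ↦
    DFunLike.congr_fun (DFunLike.congr_fun (congrArg Prod.snd h) W) x
  rw [← s.decomposition hA e x, ← s.decomposition hA e' x, h1, h2]

lemma cochainPairing_toCochain (hA : A.IsExact) (e e' : ContMDiffSection 𝓘(ℝ, E) F ∞ C) (x : M) :
    cochainPairing (s.toCochain e) (s.toCochain e') x = A.pairing x (e x) (e' x) :=
  (s.pairing_eq hA e e' x).symm

lemma vectorPart_courantBracket (hA : A.IsExact)
    (Ω : Π x : M, TangentSpace 𝓘(ℝ, E) x [⋀^Fin 3]→L[ℝ] ℝ)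
    (e₁ e₂ : ContMDiffSection 𝓘(ℝ, E) F ∞ C) :
    A.vectorPart (s.courantBracket Ω e₁ e₂) = ⁅A.vectorField e₁, A.vectorField e₂⁆ := by
  ext x
  exact s.anchor_map_add_anchorDual hA x _ _

variable {Ω : Π x : M, TangentSpace 𝓘(ℝ, E) x [⋀^Fin 3]→L[ℝ] ℝ}

lemma formPart_courantBracket_apply (hΩ : IsSmoothForm Ω)
    (e₁ e₂ : ContMDiffSection 𝓘(ℝ, E) F ∞ C) (W : SmoothVectorField E M) (x : M) :
    s.formPart (s.courantBracket Ω e₁ e₂) x (W x) =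
      (cochainBracket hΩ.trilinear (s.toCochain e₁) (s.toCochain e₂)).2 W x := by
  refine (s.pairing_map_add_anchorDual x _ _ _).trans ?_
  -- The two half-terms are recombined, since the geometric bracket differentiates the difference as
  -- a single function.
  rw [cochainBracket_snd, ← lie_sub]
  change lieDeriv (A.vectorField e₁) (s.formPart e₂) x (W x)
    - lieDeriv (A.vectorField e₂) (s.formPart e₁) x (W x)
    - (1 / 2 : ℝ) * funDeriv (fun y ↦ s.formPart e₂ y (A.vectorPart e₁ y)
      - s.formPart e₁ y (A.vectorPart e₂ y)) x (W x)
    - interior₃ (A.vectorPart e₂ x) (A.vectorPart e₁ x) (Ω x) (W x) = _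
  rw [lieDeriv_apply_vectorField (s.contMDiff_formPart_apply e₂),
    lieDeriv_apply_vectorField (s.contMDiff_formPart_apply e₁), interior₃_apply]
  rfl

/-- The twisted Courant bracket on smooth sections. -/
def courantSection (hA : A.IsExact) (hΩ : IsSmoothForm Ω)
    (e₁ e₂ : ContMDiffSection 𝓘(ℝ, E) F ∞ C) : ContMDiffSection 𝓘(ℝ, E) F ∞ C :=
  ⟨s.courantBracket Ω e₁ e₂,
    s.contMDiff_of_parts hA _ (s.vectorPart_courantBracket hA Ω e₁ e₂) fun W ↦
      (ContMDiffMap.contMDiff _).congr (s.formPart_courantBracket_apply hΩ e₁ e₂ W)⟩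

lemma toCochain_courantSection (hA : A.IsExact) (hΩ : IsSmoothForm Ω)
    (e₁ e₂ : ContMDiffSection 𝓘(ℝ, E) F ∞ C) :
    s.toCochain (s.courantSection hA hΩ e₁ e₂) =
      cochainBracket hΩ.trilinear (s.toCochain e₁) (s.toCochain e₂) := by
  refine Prod.ext ?_ ?_
  · ext x
    exact congrFun (s.vectorPart_courantBracket hA Ω e₁ e₂) x
  · ext W x
    exact s.formPart_courantBracket_apply hΩ e₁ e₂ W x

lemma vectorPart_D (hA : A.IsExact) (f : M → ℝ) :
    A.vectorPart (A.D f) = (0 : SmoothVectorField E M) := by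
  ext x
  exact hA.anchor_anchorDual x _

lemma formPart_D (f : M → ℝ) (x : M) : s.formPart (A.D f) x = funDeriv f x := by
  ext w
  exact (A.pairing_anchorDual x _ _).trans (congrArg (funDeriv f x) (s.anchor_map x w))

/-- The differential `D` with values in the smooth sections. -/
def smoothD (hA : A.IsExact) (f : SmoothFunction E M) : ContMDiffSection 𝓘(ℝ, E) F ∞ C :=
  ⟨A.D f, s.contMDiff_of_parts hA 0 (vectorPart_D hA f) fun W ↦ by
    simp only [s.formPart_D]
    exact contMDiff_funDeriv_apply f.contMDiff W.contMDiff⟩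

lemma toCochain_smoothD (hA : A.IsExact) (f : SmoothFunction E M) :
    s.toCochain (s.smoothD hA f) = (0, lieCoboundary _ _ f) := by
  refine Prod.ext ?_ ?_
  · ext x
    exact congrFun (vectorPart_D hA f) x
  · ext W x
    exact DFunLike.congr_fun (s.formPart_D f x) (W x)

/-- The Lie 2-algebra `L_∞(C)`. -/
def courantLie2Algebra (hA : A.IsExact) (hΩ : IsTwoPlectic Ω) :
    Lie2Algebra (SmoothFunction E M) (ContMDiffSection 𝓘(ℝ, E) F ∞ C) :=
  (cochainLie2Algebra hΩ.isLieThreeCocycle).comap s.toCochain (s.toCochain_injective hA)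
    (s.smoothD hA) (s.toCochain_smoothD hA)
    (s.courantSection hA hΩ.smooth) (s.toCochain_courantSection hA hΩ.smooth)

lemma isCourantLie2Algebra_courantLie2Algebra (hA : A.IsExact) (hΩ : IsTwoPlectic Ω) :
    s.IsCourantLie2Algebra Ω (s.courantLie2Algebra hA hΩ) where
  d_eq _ _ := rfl
  bracket₀_eq _ _ _ := rfl
  bracket₁_eq e f x := by
    rw [A.pairing_symm, D, pairing_anchorDual]
    rfl
  J_eq e₁ e₂ e₃ x := by
    have h (a b c : ContMDiffSection 𝓘(ℝ, E) F ∞ C) :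
        cochainPairing (cochainBracket hΩ.smooth.trilinear (s.toCochain a) (s.toCochain b))
          (s.toCochain c) x = A.pairing x (s.courantBracket Ω a b x) (c x) := by
      rw [← s.toCochain_courantSection hA]
      exact s.cochainPairing_toCochain hA _ c x
    rw [← h, ← h, ← h]
    rfl

/-- The sections `s(v) + ρ* α` with `dα = -ι_v Ω`. -/
def preservingSubmodule (hΩ : IsSmoothForm Ω) : Submodule ℝ (ContMDiffSection 𝓘(ℝ, E) F ∞ C) :=
  (cochainPreserving hΩ.trilinear).comap s.toCochain

/-- By isotropy `s(V)` has zero 1-form, so the Lie derivative term drops out. -/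
lemma dorfmanBracket_map (Ω : Π x : M, TangentSpace 𝓘(ℝ, E) x [⋀^Fin 3]→L[ℝ] ℝ)
    (e : ContMDiffSection 𝓘(ℝ, E) F ∞ C) (V : SmoothVectorField E M) (x : M) :
    s.dorfmanBracket Ω e (fun y ↦ s.map y (V y)) x =
      s.map x (VectorField.mlieBracket 𝓘(ℝ, E) (A.vectorPart e) V x)
        + A.anchorDual x (-interior₂ (V x) (oneFormDeriv (s.formPart e) x)
          - interior₃ (V x) (A.vectorPart e x) (Ω x)) := by
  have h1 : A.vectorPart (fun y ↦ s.map y (V y)) = V := funext fun y ↦ s.anchor_map y _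
  have h2 : s.formPart (fun y ↦ s.map y (V y)) = fun _ ↦ 0 := funext fun y ↦
    ContinuousLinearMap.ext fun w ↦ s.isotropic y _ _
  have h3 : lieDeriv (A.vectorPart e)
      (fun y ↦ (0 : TangentSpace 𝓘(ℝ, E) y →L[ℝ] ℝ)) x = 0 := lieDeriv_zero (A.vectorField e) x
  simp only [dorfmanBracket, h1, h2, h3, zero_sub]

/-- Injectivity of `ρ*` turns the Dorfman condition into the vanishing of a covector, which may be
tested on smooth vector fields `W`; the invariant formula for `dα` then gives the cochain condition
up to sign. -/
lemma coe_preservingSubmodule (hA : A.IsExact) (hΩ : IsSmoothForm Ω) :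
    (s.preservingSubmodule hΩ : Set (ContMDiffSection 𝓘(ℝ, E) F ∞ C)) =
      s.preservingSections Ω := by
  ext e
  simp only [preservingSections, mem_ofPred_eq, dorfmanBracket_map, add_eq_left,
    anchorDual_eq_zero_iff A hA]
  have key (V W : SmoothVectorField E M) (x : M) :
      (-interior₂ (V x) (oneFormDeriv (s.formPart e) x)
        - interior₃ (V x) (A.vectorPart e x) (Ω x)) (W x) =
      -(⁅V, (s.toCochain e).2 W⁆ - ⁅W, (s.toCochain e).2 V⁆ - (s.toCochain e).2 ⁅V, W⁆
        + hΩ.trilinear (s.toCochain e).1 V W) x := by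
    rw [sub_apply, neg_apply, interior₂_apply, interior₃_apply,
      oneFormDeriv_apply_vectorField (s.contMDiff_formPart_apply e), ← neg_add']
    rfl
  change s.toCochain e ∈ cochainPreserving hΩ.trilinear ↔ _
  rw [mem_cochainPreserving]
  refine ⟨fun h V x ↦ covector_ext fun W ↦ ?_, fun h V W ↦ ?_⟩
  · rw [key, h]
    exact neg_zero
  · ext x
    have hx := key V W x
    rw [h] at hx
    exact neg_eq_zero.1 hx.symm

lemma courantLie2Algebra_d_mem (hA : A.IsExact) (hΩ : IsTwoPlectic Ω) (f : SmoothFunction E M) :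
    (s.courantLie2Algebra hA hΩ).d f ∈ s.preservingSubmodule hΩ.smooth := by
  change s.toCochain (s.smoothD hA f) ∈ cochainPreserving hΩ.smooth.trilinear
  rw [toCochain_smoothD]
  exact cochainLie2Algebra_d_mem hΩ.isLieThreeCocycle f

lemma courantLie2Algebra_bracket₀_mem (hA : A.IsExact) (hΩ : IsTwoPlectic Ω)
    {e₁ e₂ : ContMDiffSection 𝓘(ℝ, E) F ∞ C} (h₁ : e₁ ∈ s.preservingSubmodule hΩ.smooth)
    (h₂ : e₂ ∈ s.preservingSubmodule hΩ.smooth) :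
    (s.courantLie2Algebra hA hΩ).bracket₀ e₁ e₂ ∈ s.preservingSubmodule hΩ.smooth := by
  change s.toCochain (s.courantSection hA hΩ.smooth e₁ e₂) ∈ cochainPreserving hΩ.smooth.trilinear
  rw [toCochain_courantSection]
  exact cochainBracket_mem hΩ.isLieThreeCocycle h₁ h₂

end Splitting

end PairedAnchoredBundle

end Courant

end

/-! ### The sub-Lie 2-algebra and the theorem. -/

/-- A subspace containing the image of the differential and closed under the bracket carries a
sub-Lie 2-algebra. -/
lemma Lie2Algebra.exists_isRestriction {L₁ L₀ : Type*} [AddCommGroup L₁] [Module ℝ L₁]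
    [AddCommGroup L₀] [Module ℝ L₀] (L : Lie2Algebra L₁ L₀) (S : Submodule ℝ L₀)
    (hd : ∀ f, L.d f ∈ S) (hb : ∀ x ∈ S, ∀ y ∈ S, L.bracket₀ x y ∈ S) :
    ∃ K : Lie2Algebra L₁ S, L.IsRestriction K :=
  ⟨L.comap S.subtype S.subtype_injective (fun f ↦ ⟨L.d f, hd f⟩) (fun _ ↦ rfl)
    (fun x y ↦ ⟨L.bracket₀ x y, hb x x.2 y y.2⟩) (fun _ _ ↦ rfl),
    ⟨fun _ ↦ rfl, fun _ _ ↦ rfl, fun _ _ ↦ rfl, fun _ _ _ ↦ rfl⟩⟩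

theorem mainTheorem9
    {E : Type*} [NormedAddCommGroup E] [NormedSpace ℝ E] [FiniteDimensional ℝ E]
    {M : Type*} [TopologicalSpace M] [T2Space M] [SigmaCompactSpace M]
    [ChartedSpace E M] [IsManifold 𝓘(ℝ, E) ∞ M]
    (Ω : Π x : M, TangentSpace 𝓘(ℝ, E) x [⋀^Fin 3]→L[ℝ] ℝ) (hΩ : IsTwoPlectic Ω)
    {F : Type*} [NormedAddCommGroup F] [NormedSpace ℝ F] [FiniteDimensional ℝ F]
    {C : M → Type*} [TopologicalSpace (TotalSpace F C)]
    [∀ x, TopologicalSpace (C x)] [∀ x, AddCommGroup (C x)] [∀ x, Module ℝ (C x)]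
    [∀ x, IsTopologicalAddGroup (C x)] [∀ x, ContinuousSMul ℝ (C x)]
    [FiberBundle F C] [VectorBundle ℝ F C] [ContMDiffVectorBundle ∞ F C 𝓘(ℝ, E)]
    (A : PairedAnchoredBundle E F C) (hA : A.IsExact) (s : A.Splitting) :
    ∃ (L : Lie2Algebra (ContMDiffMap 𝓘(ℝ, E) 𝓘(ℝ, ℝ) M ℝ ∞) (ContMDiffSection 𝓘(ℝ, E) F ∞ C))
      (S : Submodule ℝ (ContMDiffSection 𝓘(ℝ, E) F ∞ C)),
      s.IsCourantLie2Algebra Ω L ∧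
      (S : Set (ContMDiffSection 𝓘(ℝ, E) F ∞ C)) = s.preservingSections Ω ∧
      (∀ f, L.d f ∈ S) ∧
      (∀ e₁ ∈ S, ∀ e₂ ∈ S, L.bracket₀ e₁ e₂ ∈ S) ∧
      ∃ K : Lie2Algebra (ContMDiffMap 𝓘(ℝ, E) 𝓘(ℝ, ℝ) M ℝ ∞) S, L.IsRestriction K := by
  have hd := s.courantLie2Algebra_d_mem hA hΩ
  have hb := fun e₁ h₁ e₂ h₂ ↦
    s.courantLie2Algebra_bracket₀_mem (e₁ := e₁) (e₂ := e₂) hA hΩ h₁ h₂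
  exact ⟨s.courantLie2Algebra hA hΩ, s.preservingSubmodule hΩ.smooth,
    s.isCourantLie2Algebra_courantLie2Algebra hA hΩ, s.coe_preservingSubmodule hA hΩ.smooth, hd, hb,
    Lie2Algebra.exists_isRestriction _ _ hd hb⟩
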